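/- Regard $\mathbb Z^3$ as a graph by joining two points when their $\ell^1$-distance is $1$, and let $d$ be its graph metric. For a function $h$ defined on $[0,\infty)$, the wedge $\mathcal W_h$ is the subgraph of $\mathbb Z^3$ induced by the vertex set $\{(x,y,z)\in\mathbb Z^3 : x\ge 0,\ |z|\le h(x)\}$. Fix a vertex $v_0\in\mathbb Z^3$. For $C>0$, the $C$-core of a subgraph $A$ of $\mathbb Z^3$ is the subgraph of $A$ induced by $\{v\in A : d(v,\partial A)>C\log d(v,v_0)\}$, where $\partial A$ is the set of vertices outside $A$ that have a neighbour in $A$, and $\log 0=-\infty$. A locally finite graph is called transient if simple random walk on it, started at some vertex, has positive probability of never returning to that vertex (an isolated vertex is never a transient starting point). **Lemma.** Let $h:[0,\infty)\to\mathbb R$ be nondecreasing and suppose that the wedge $\mathcal W_h$ is transient. Then for every choice of $v_0\in\mathbb Z^3$ and every $C>0$, the $C$-core of $\mathcal W_h$ is transient as well. -/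

import Mathlib

open scoped ENNReal

namespace WedgeCore

noncomputable section

/-! ### Simple random walk and transience -/

section Walk

variable {V : Type*} (G : SimpleGraph V) [G.LocallyFinite]

open Classical in
/-- One step of simple random walk on a locally finite graph: a uniformly chosen neighbour of `v`.
(At an isolated vertex the walk stays where it is.) -/
def step (v : V) : PMF V :=
  if hv : (G.neighborFinset v).Nonempty then PMF.uniformOfFinset (G.neighborFinset v) hv
  else PMF.pure v

/-- The law of the trajectory `[X₁, …, Xₙ]` of the first `n` steps of simple random walk on `G`
started at `X₀ = v`. -/
def trajectory : ℕ → V → PMF (List V)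
  | 0, _ => PMF.pure []
  | n + 1, v => (step G v).bind fun w => (trajectory n w).map (w :: ·)

/-- The probability that simple random walk started at `v` returns to `v`: the (increasing) limit
of the probabilities that `v ∈ {X₁, …, Xₙ}`. -/
def returnProb (v : V) : ℝ≥0∞ :=
  ⨆ n : ℕ, (trajectory G n v).toOuterMeasure {l | v ∈ l}

/-- A locally finite graph is transient if simple random walk on it is transient, i.e. if, started
at some vertex, it has positive probability of never returning there. Whether this
happens depends only on the connected component of the vertex; a graph which is not
connected is transient when one of its components is. -/
def Transient : Prop :=
  ∃ v : V, returnProb G v < 1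

end Walk

/-! ### The core of a set of vertices -/

section Core

variable {V : Type*} (G : SimpleGraph V)

/-- The vertex boundary of `A`: the vertices outside `A` with a neighbour in `A`. -/
def boundary (A : Set V) : Set V :=
  {w | w ∉ A ∧ ∃ a ∈ A, G.Adj a w}

/-- The vertex set of the `C`-core of (the subgraph induced by) `A`, with base vertex `v₀`, in a
connected graph `G` with graph metric `d = G.dist`: all `v ∈ A` with
`d(v, ∂A) > C log d(v, v₀)`. As distances are natural numbers, the infimum defining `d(v, ∂A)` is
attained, so that the inequality is the one below, for all `w ∈ ∂A`. For `v = v₀`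
it holds, as it does with `log 0 = -∞`: here `Real.log 0 = 0`, and `d(v, w) > 0` since `w ∉ A`. -/
def core (C : ℝ) (v₀ : V) (A : Set V) : Set V :=
  {v | v ∈ A ∧ ∀ w ∈ boundary G A, C * Real.log (G.dist v v₀) < G.dist v w}

end Core

/-! ### The lattice `ℤ³` and wedges -/

/-- The nearest-neighbour graph on `ℤ³`. -/
def lattice : SimpleGraph (ℤ × ℤ × ℤ) where
  Adj p q := |p.1 - q.1| + |p.2.1 - q.2.1| + |p.2.2 - q.2.2| = 1
  symm := ⟨fun p q h => by
    rwa [abs_sub_comm q.1, abs_sub_comm q.2.1, abs_sub_comm q.2.2]⟩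
  loopless := ⟨fun p h => by simp at h⟩

theorem lattice_neighborSet_finite (p : ℤ × ℤ × ℤ) : (lattice.neighborSet p).Finite := by
  refine (Set.finite_Icc (p.1 - 1, p.2.1 - 1, p.2.2 - 1) (p.1 + 1, p.2.1 + 1, p.2.2 + 1)).subset ?_
  rintro ⟨x, y, z⟩ (h : |p.1 - x| + |p.2.1 - y| + |p.2.2 - z| = 1)
  simp only [Set.mem_Icc, Prod.mk_le_mk]
  grind

/-- Induced subgraphs of `ℤ³` are locally finite. -/
instance latticeInduceLocallyFinite (A : Set (ℤ × ℤ × ℤ)) : (lattice.induce A).LocallyFinite :=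
  fun v => (Set.Finite.preimage Subtype.val_injective.injOn
    (lattice_neighborSet_finite v.1)).fintype

/-- The vertex set of the wedge `𝒲_h`: all `(x, y, z) ∈ ℤ³` with `x ≥ 0` and `|z| ≤ h(x)`. -/
def wedge (h : ℝ → ℝ) : Set (ℤ × ℤ × ℤ) :=
  {p | 0 ≤ p.1 ∧ |(p.2.2 : ℝ)| ≤ h p.1}

end

end WedgeCore

/-!
Transience is characterised by energies of finitely supported functions, and the wedge and the core
are compared through a single numerical condition, the convergence of `∑ 1 / (⌊h (2 ^ k)⌋₊ + 1)`.

**Transience and capacity.** Let `o` be a vertex of a locally finite graph. If the walk from `o`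
may fail to return, then the probability of ever visiting `o` is superharmonic, strictly so at `o`,
and the inequality `(a² / s - b² / t) (s - t) ≤ (a - b)²` together with Green's identity shows that
`f o ^ 2` is at most a constant times the energy of `f`, for `f` finitely supported
(`Transient.exists_le_energy`). Conversely, the probability of visiting `o` within `n` steps is a
finitely supported function whose energy is at most `2 deg o` times the probability of not
returning within `n + 1` steps; so a lower bound for energies bounds the escape probability from
below (`transient_of_le_energy`).

**The wedge.** There are `O((n + 1) (h n + 1))` vertices of the wedge with `|x| + |y| = n`. A radial
function with increments `1 / ((n + 1) (h n + 1))` has energy at most a constant times the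
sum of its increments, which contradicts positive capacity unless that sum converges
(`summable_resistance`). By Cauchy condensation, `∑ 1 / (h (2 ^ k) + 1)` converges
(`summable_inv_height`).

**The core.** Since the terms of this series decrease, `h (2 ^ k) / k → ∞`. Hence the distance
`≳ min (2 ^ (k - 1), h (2 ^ (k - 1)) / 2)` to the complement of the wedge beats the logarithm on
the boxes `2 ^ k ≤ x < 2 ^ (k + 2)`, `0 ≤ y < 2 ^ (k + 1)`, `0 ≤ z < G k`, where `G k` is the
minimum of `2 ^ k` and about half of `h (2 ^ (k - 1))`, and these lie in the core for `k` large
(`exists_octant_mem_core`). The averages of a function over consecutive dyadic boxes differ, in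
square, by at most `15 / G k` times the energy near these boxes (`sq_dyadicAvg_sub_le`). For a
finitely supported function the averages telescope to zero, and as `∑ 1 / G k` converges,
the Cauchy–Schwarz inequality bounds the first average by the energy
(`sq_dyadicAvg_le_energy`). So the core has positive capacity.
-/

namespace WedgeCore

/-! ### Hitting probabilities -/

section Graph

variable {V : Type*} (G : SimpleGraph V) [G.LocallyFinite]

open Classical in
/-- The probability that simple random walk started at `v` visits `o` at one of the times
`0, …, n`, given by its first-step recursion. Away from `o`, the value at an isolated vertex
is `0 / 0 = 0`, as it should be. -/
noncomputable def hit (o : V) : ℕ → V → ℝ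
  | 0, v => if v = o then 1 else 0
  | n + 1, v => if v = o then 1 else (∑ w ∈ G.neighborFinset v, hit o n w) / G.degree v

variable {G}

theorem hit_self (o : V) (n : ℕ) : hit G o n o = 1 := by
  cases n <;> simp [hit]

theorem hit_nonneg (o : V) (n : ℕ) (v : V) : 0 ≤ hit G o n v := by
  induction n generalizing v with
  | zero => simp only [hit]; split_ifs <;> norm_num
  | succ n ih =>
    simp only [hit]
    split_ifs
    · norm_num
    · exact div_nonneg (Finset.sum_nonneg fun w _ => ih w) (Nat.cast_nonneg _)

theorem hit_le_one (o : V) (n : ℕ) (v : V) : hit G o n v ≤ 1 := by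
  induction n generalizing v with
  | zero => simp only [hit]; split_ifs <;> norm_num
  | succ n ih =>
    simp only [hit]
    split_ifs
    · norm_num
    · refine div_le_one_of_le₀ ?_ (Nat.cast_nonneg _)
      calc ∑ w ∈ G.neighborFinset v, hit G o n w ≤ ∑ w ∈ G.neighborFinset v, (1 : ℝ) :=
            Finset.sum_le_sum fun w _ => ih w
        _ = G.degree v := by simp

theorem hit_le_succ (o : V) (n : ℕ) (v : V) : hit G o n v ≤ hit G o (n + 1) v := by
  induction n generalizing v with
  | zero =>
    by_cases hv : v = o
    · simp [hit, hv]
    · refine le_trans (by simp [hit, hv]) (hit_nonneg o 1 v)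
  | succ n ih =>
    by_cases hv : v = o
    · simp [hv, hit_self]
    · rw [hit, hit, if_neg hv, if_neg hv]
      gcongr with w
      exact ih w

theorem hit_monotone (o v : V) : Monotone fun n => hit G o n v :=
  monotone_nat_of_le_succ fun n => hit_le_succ o n v

open Classical in
theorem hit_support_finite (o : V) (n : ℕ) : ∃ S : Finset V, ∀ v ∉ S, hit G o n v = 0 := by
  induction n with
  | zero => exact ⟨{o}, fun v hv => by simp_all [hit]⟩
  | succ n ih =>
    obtain ⟨S, hS⟩ := ih
    refine ⟨insert o (S.biUnion fun w => G.neighborFinset w), fun v hv => ?_⟩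
    simp only [Finset.mem_insert, Finset.mem_biUnion, not_or, not_exists, not_and] at hv
    rw [hit, if_neg hv.1, Finset.sum_eq_zero, zero_div]
    intro w hw
    refine hS w fun hwS => hv.2 w hwS ?_
    simpa [G.adj_comm] using hw

theorem trajectory_succ_mem (n : ℕ) (v o : V) [DecidableEq V] :
    (trajectory G (n + 1) v).toOuterMeasure {l | o ∈ l} =
      ∑' w, step G v w *
        (if w = o then 1 else (trajectory G n w).toOuterMeasure {l | o ∈ l}) := by
  rw [trajectory, PMF.toOuterMeasure_bind_apply]
  refine tsum_congr fun w => ?_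
  congr 1
  rw [PMF.toOuterMeasure_map_apply]
  split_ifs with h
  · subst h
    rw [PMF.toOuterMeasure_apply_eq_one_iff]
    intro l _
    simp
  · congr 1
    ext l
    simp [Ne.symm h]

theorem tsum_step_mul_of_neighbor {v : V} (hv : (G.neighborFinset v).Nonempty) (f : V → ℝ)
    (hf : ∀ w, 0 ≤ f w) :
    ∑' w, step G v w * ENNReal.ofReal (f w) =
      ENNReal.ofReal ((∑ w ∈ G.neighborFinset v, f w) / G.degree v) := by
  have hd : (0 : ℝ) < G.degree v := by
    rw [← G.card_neighborFinset_eq_degree]; exact_mod_cast hv.card_pos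
  rw [tsum_eq_sum (s := G.neighborFinset v), Finset.sum_div, ENNReal.ofReal_sum_of_nonneg]
  · refine Finset.sum_congr rfl fun w hw => ?_
    rw [step, dif_pos hv, PMF.uniformOfFinset_apply_of_mem hv hw, div_eq_inv_mul,
      ENNReal.ofReal_mul (by positivity), ENNReal.ofReal_inv_of_pos hd]
    simp
  · intro w _
    exact div_nonneg (hf w) hd.le
  · intro w hw
    rw [step, dif_pos hv, PMF.uniformOfFinset_apply_of_notMem hv hw, zero_mul]

theorem tsum_step_mul_of_isolated {v : V} (hv : ¬(G.neighborFinset v).Nonempty) (f : V → ℝ≥0∞) :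
    ∑' w, step G v w * f w = f v := by
  rw [tsum_eq_single v]
  · simp [step, dif_neg hv]
  · intro w hw
    simp [step, dif_neg hv, hw]

open Classical in
theorem ofReal_hit (o : V) (n : ℕ) (v : V) :
    (if v = o then 1 else (trajectory G n v).toOuterMeasure {l | o ∈ l}) =
      ENNReal.ofReal (hit G o n v) := by
  induction n generalizing v with
  | zero =>
    by_cases hv : v = o <;> simp [hit, hv, trajectory]
  | succ n ih =>
    by_cases hv : v = o
    · simp [hv, hit_self]
    · rw [if_neg hv, trajectory_succ_mem]
      simp_rw [ih]
      by_cases hN : (G.neighborFinset v).Nonempty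
      · rw [tsum_step_mul_of_neighbor hN _ (hit_nonneg o n), hit, if_neg hv]
      · rw [tsum_step_mul_of_isolated hN, ← ih v, if_neg hv]
        -- an isolated vertex different from `o` never leads to `o`
        have h0 : hit G o (n + 1) v = 0 := by
          rw [hit, if_neg hv, Finset.not_nonempty_iff_eq_empty.1 hN]; simp
        have h1 := hit_le_succ (G := G) o n v
        have h2 : hit G o n v = 0 := le_antisymm (h0 ▸ h1) (hit_nonneg o n v)
        have := ih v
        rw [if_neg hv, h2] at this
        rw [this, h0]

/-- The return probability within `n + 1` steps, for a vertex that is not isolated. -/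
theorem trajectory_return {o : V} (ho : 0 < G.degree o) (n : ℕ) :
    (trajectory G (n + 1) o).toOuterMeasure {l | o ∈ l} =
      ENNReal.ofReal ((∑ w ∈ G.neighborFinset o, hit G o n w) / G.degree o) := by
  classical
  rw [trajectory_succ_mem]
  simp_rw [ofReal_hit]
  refine tsum_step_mul_of_neighbor ?_ _ (hit_nonneg o n)
  rwa [← Finset.card_pos, G.card_neighborFinset_eq_degree]

theorem returnProb_le_of_forall {o : V} {p : ℝ} (ho : 0 < G.degree o)
    (h : ∀ n, (∑ w ∈ G.neighborFinset o, hit G o n w) / G.degree o ≤ p) :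
    returnProb G o ≤ ENNReal.ofReal p := by
  refine iSup_le fun n => ?_
  cases n with
  | zero => simp [trajectory]
  | succ n => rw [trajectory_return ho]; exact ENNReal.ofReal_le_ofReal (h n)

theorem degree_pos_of_returnProb_lt_one {o : V} (h : returnProb G o < 1) : 0 < G.degree o := by
  classical
  by_contra hd
  have hN : ¬(G.neighborFinset o).Nonempty := by
    rwa [← Finset.card_pos, G.card_neighborFinset_eq_degree]
  refine absurd (le_iSup (fun n => (trajectory G n o).toOuterMeasure {l | o ∈ l}) (0 + 1)) ?_
  show ¬ (trajectory G (0 + 1) o).toOuterMeasure {l | o ∈ l} ≤ returnProb G o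
  rw [trajectory_succ_mem, tsum_step_mul_of_isolated hN, if_pos rfl]
  exact not_le.2 h

theorem exists_hit_le_of_returnProb_lt_one {o : V} (h : returnProb G o < 1) :
    ∃ p < (1 : ℝ), ∀ n, (∑ w ∈ G.neighborFinset o, hit G o n w) / G.degree o ≤ p := by
  have hd := degree_pos_of_returnProb_lt_one h
  refine ⟨(returnProb G o).toReal, by
    simpa using ENNReal.toReal_strict_mono ENNReal.one_ne_top h, fun n => ?_⟩
  rw [← ENNReal.ofReal_le_iff_le_toReal h.ne_top, ← trajectory_return hd]
  exact le_iSup (fun n => (trajectory G n o).toOuterMeasure {l | o ∈ l}) (n + 1)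

/-! ### Dirichlet forms and transience -/

open Classical in
/-- Summation over the neighbours, written as a sum over a finite set `T` containing the support
of the summand. -/
theorem sum_neighborFinset_eq {S T : Finset V} (hST : S ⊆ T)
    (hT : ∀ v ∈ S, ∀ w, G.Adj v w → w ∈ T) (a : V → V → ℝ)
    (ha : ∀ v w, v ∉ S → w ∉ S → a v w = 0) {v : V} :
    ∑ w ∈ G.neighborFinset v, a v w = ∑ w ∈ T, if G.Adj v w then a v w else 0 := by
  rw [← Finset.sum_filter]
  symm
  refine Finset.sum_subset ?_ ?_
  · intro w hw
    simpa using (Finset.mem_filter.1 hw).2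
  · intro w hw hw'
    simp only [SimpleGraph.mem_neighborFinset] at hw
    have hwT : w ∉ T := fun h => hw' (Finset.mem_filter.2 ⟨h, hw⟩)
    exact ha v w (fun h => hwT (hT v h w hw)) fun h => hwT (hST h)

theorem sum_neighborFinset_swap {S T : Finset V} (hST : S ⊆ T)
    (hT : ∀ v ∈ S, ∀ w, G.Adj v w → w ∈ T) (a : V → V → ℝ)
    (ha : ∀ v w, v ∉ S → w ∉ S → a v w = 0) :
    ∑ v ∈ T, ∑ w ∈ G.neighborFinset v, a v w = ∑ v ∈ T, ∑ w ∈ G.neighborFinset v, a w v := by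
  classical
  simp_rw [sum_neighborFinset_eq hST hT a ha,
    sum_neighborFinset_eq hST hT (fun v w => a w v) fun v w hv hw => ha w v hw hv]
  rw [Finset.sum_comm]
  simp_rw [G.adj_comm]

/-- Green's identity, for a function `f` supported in the finite set `S`. -/
theorem green {S T : Finset V} (hST : S ⊆ T)
    (hT : ∀ v ∈ S, ∀ w, G.Adj v w → w ∈ T) (f g : V → ℝ) (hf : ∀ v ∉ S, f v = 0) :
    ∑ v ∈ T, ∑ w ∈ G.neighborFinset v, (f v - f w) * (g v - g w) =
      2 * ∑ v ∈ S, f v * ∑ w ∈ G.neighborFinset v, (g v - g w) := by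
  have key : ∑ v ∈ T, ∑ w ∈ G.neighborFinset v, f v * (g v - g w) =
      ∑ v ∈ S, f v * ∑ w ∈ G.neighborFinset v, (g v - g w) := by
    symm
    simp_rw [Finset.mul_sum]
    refine Finset.sum_subset hST fun v _ hv => ?_
    simp [hf v hv]
  have hsw := sum_neighborFinset_swap hST hT (fun v w => f v * (g v - g w))
    fun v w hv _ => by simp [hf v hv]
  calc ∑ v ∈ T, ∑ w ∈ G.neighborFinset v, (f v - f w) * (g v - g w)
      = ∑ v ∈ T, ∑ w ∈ G.neighborFinset v, f v * (g v - g w) +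
          ∑ v ∈ T, ∑ w ∈ G.neighborFinset v, f w * (g w - g v) := by
        simp_rw [← Finset.sum_add_distrib]
        exact Finset.sum_congr rfl fun v _ => Finset.sum_congr rfl fun w _ => by ring
    _ = _ := by rw [← hsw, key]; ring

open Classical in
theorem exists_superset_neighbors (S : Finset V) :
    ∃ T : Finset V, S ⊆ T ∧ ∀ v ∈ S, ∀ w, G.Adj v w → w ∈ T := by
  refine ⟨S ∪ S.biUnion fun v => G.neighborFinset v, Finset.subset_union_left,
    fun v hv w hw => Finset.mem_union_right _ (Finset.mem_biUnion.2 ⟨v, hv, by simpa using hw⟩)⟩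

theorem sq_div_sub_mul_le {a b s t : ℝ} (hs : 0 < s) (ht : 0 < t) :
    (a ^ 2 / s - b ^ 2 / t) * (s - t) ≤ (a - b) * (a - b) := by
  have h : (a - b) * (a - b) - (a ^ 2 / s - b ^ 2 / t) * (s - t) =
      (a * t - b * s) ^ 2 / (s * t) := by
    field_simp
    ring
  have : 0 ≤ (a * t - b * s) ^ 2 / (s * t) := by positivity
  linarith

/-- A transient graph carries a bounded positive superharmonic function, harmonic away from a
single vertex `o`: one plus the probability of ever visiting `o`. -/
theorem Transient.exists_superharmonic (h : Transient G) :
    ∃ o : V, ∃ u : V → ℝ, ∃ ε > 0, (∀ v, 1 ≤ u v) ∧ (∀ v, u v ≤ 2) ∧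
      (∀ v, v ≠ o → ∑ w ∈ G.neighborFinset v, (u v - u w) = 0) ∧
      ε ≤ ∑ w ∈ G.neighborFinset o, (u o - u w) := by
  obtain ⟨o, ho⟩ := h
  have hd : (0 : ℝ) < G.degree o := by exact_mod_cast degree_pos_of_returnProb_lt_one ho
  obtain ⟨p, hp, hle⟩ := exists_hit_le_of_returnProb_lt_one ho
  have hbdd : ∀ v, BddAbove (Set.range fun n => hit G o n v) := fun v =>
    ⟨1, by rintro _ ⟨n, rfl⟩; exact hit_le_one o n v⟩
  set q : V → ℝ := fun v => ⨆ n, hit G o n v with hq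
  have hlim : ∀ v, Filter.Tendsto (fun n => hit G o n v) Filter.atTop (nhds (q v)) :=
    fun v => tendsto_atTop_ciSup (hit_monotone o v) (hbdd v)
  have hsum : ∀ v, Filter.Tendsto (fun n => ∑ w ∈ G.neighborFinset v, hit G o n w)
      Filter.atTop (nhds (∑ w ∈ G.neighborFinset v, q w)) :=
    fun v => tendsto_finsetSum _ fun w _ => hlim w
  refine ⟨o, fun v => q v + 1, G.degree o * (1 - p), mul_pos hd (by linarith), fun v => ?_,
    fun v => ?_, fun v hv => ?_, ?_⟩
  · have := ge_of_tendsto' (hlim v) fun n => hit_nonneg o n v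
    linarith
  · have := le_of_tendsto' (hlim v) fun n => hit_le_one o n v
    linarith
  · simp only [add_sub_add_right_eq_sub, Finset.sum_sub_distrib, Finset.sum_const,
      G.card_neighborFinset_eq_degree, nsmul_eq_mul]
    rcases Nat.eq_zero_or_pos (G.degree v) with h0 | h0
    · have : G.neighborFinset v = ∅ := by
        rwa [← Finset.card_eq_zero, G.card_neighborFinset_eq_degree]
      simp [h0, this]
    · have h0' : (0 : ℝ) < G.degree v := by exact_mod_cast h0
      have hlim' := (hlim v).comp (Filter.tendsto_add_atTop_nat 1)
      have heq : q v = (∑ w ∈ G.neighborFinset v, q w) / G.degree v := by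
        refine tendsto_nhds_unique hlim' (((hsum v).div_const _).congr fun n => ?_)
        simp [hit, hv]
      rw [heq]
      field_simp
      ring
  · simp only [add_sub_add_right_eq_sub, Finset.sum_sub_distrib, Finset.sum_const,
      G.card_neighborFinset_eq_degree, nsmul_eq_mul]
    have hq1 : q o = 1 := by simp [hq, hit_self]
    have := le_of_tendsto' ((hsum o).div_const (G.degree o : ℝ)) hle
    rw [div_le_iff₀ hd] at this
    rw [hq1]
    linarith

/-- On a transient graph, some vertex `o` has positive capacity: the energy of a nonnegative
finitely supported function `f` is at least a constant times `f o ^ 2`. The energy counts each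
edge once, at the endpoint where `f` is larger. -/
theorem Transient.exists_le_energy (h : Transient G) :
    ∃ o : V, ∃ c > 0, ∀ (f : V → ℝ) (S : Finset V), (∀ v, 0 ≤ f v) → (∀ v ∉ S, f v = 0) →
      c * f o ^ 2 ≤ ∑ v ∈ S, ∑ w ∈ G.neighborFinset v, (max (f v - f w) 0) ^ 2 := by
  obtain ⟨o, u, ε, hε, hu1, hu2, hharm, hoε⟩ := h.exists_superharmonic
  refine ⟨o, ε / 2, by positivity, fun f S hf0 hfS => ?_⟩
  obtain ⟨T, hST, hT⟩ := exists_superset_neighbors (G := G) S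
  have hupos : ∀ v, 0 < u v := fun v => by linarith [hu1 v]
  have hgreen := green hST hT (fun v => f v ^ 2 / u v) u fun v hv => by simp [hfS v hv]
  have hle : ∑ v ∈ T, ∑ w ∈ G.neighborFinset v, (f v ^ 2 / u v - f w ^ 2 / u w) * (u v - u w) ≤
      ∑ v ∈ T, ∑ w ∈ G.neighborFinset v, (f v - f w) * (f v - f w) := by
    exact Finset.sum_le_sum fun v _ => Finset.sum_le_sum fun w _ =>
      sq_div_sub_mul_le (hupos v) (hupos w)
  have hsplit : ∑ v ∈ T, ∑ w ∈ G.neighborFinset v, (f v - f w) * (f v - f w) =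
      2 * ∑ v ∈ T, ∑ w ∈ G.neighborFinset v, (max (f v - f w) 0) ^ 2 := by
    rw [two_mul]
    nth_rewrite 2 [sum_neighborFinset_swap hST hT (fun v w => (max (f v - f w) 0) ^ 2)
      fun v w hv hw => by simp [hfS v hv, hfS w hw]]
    simp_rw [← Finset.sum_add_distrib]
    refine Finset.sum_congr rfl fun v _ => Finset.sum_congr rfl fun w _ => ?_
    rcases le_total (f v) (f w) with hvw | hvw
    · rw [max_eq_right (by linarith), max_eq_left (by linarith)]; ring
    · rw [max_eq_left (by linarith), max_eq_right (by linarith)]; ring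
  have hS : ∑ v ∈ T, ∑ w ∈ G.neighborFinset v, (max (f v - f w) 0) ^ 2 =
      ∑ v ∈ S, ∑ w ∈ G.neighborFinset v, (max (f v - f w) 0) ^ 2 := by
    symm
    refine Finset.sum_subset hST fun v _ hv => Finset.sum_eq_zero fun w _ => ?_
    rw [hfS v hv, max_eq_right (by linarith [hf0 w])]
    simp
  have hlow : ε / 2 * f o ^ 2 ≤
      ∑ v ∈ S, f v ^ 2 / u v * ∑ w ∈ G.neighborFinset v, (u v - u w) := by
    by_cases ho : o ∈ S
    · rw [Finset.sum_eq_single_of_mem o ho fun v _ hv => by rw [hharm v hv, mul_zero]]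
      have h1 : f o ^ 2 / 2 ≤ f o ^ 2 / u o := by
        gcongr
        · exact hupos o
        · exact hu2 o
      calc ε / 2 * f o ^ 2 = f o ^ 2 / 2 * ε := by ring
        _ ≤ _ := mul_le_mul h1 hoε hε.le (div_nonneg (sq_nonneg _) (hupos o).le)
    · rw [hfS o ho]
      refine le_of_eq_of_le (by ring) (Finset.sum_nonneg fun v hv => ?_)
      rw [hharm v fun h => ho (h ▸ hv), mul_zero]
  linarith

/-- Positive capacity of a vertex implies transience. The test functions are the probabilities of
visiting `o` within `n` steps: being subharmonic away from `o`, they have energy at most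
`2 * G.degree o` times the probability of no return within `n + 1` steps. -/
theorem transient_of_le_energy {o : V} {c : ℝ} (hc : 0 < c)
    (h : ∀ (f : V → ℝ) (S : Finset V), (∀ v, 0 ≤ f v) → (∀ v ∉ S, f v = 0) →
      ∃ T : Finset V, c * f o ^ 2 ≤ ∑ v ∈ T, ∑ w ∈ G.neighborFinset v, (f v - f w) ^ 2) :
    Transient G := by
  classical
  have main : ∀ n, c ≤ 2 * (G.degree o - ∑ w ∈ G.neighborFinset o, hit G o n w) := by
    intro n
    set f := hit G o n with hfdef
    obtain ⟨S, hS⟩ := hit_support_finite (G := G) o n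
    obtain ⟨T₁, hT₁⟩ := h f S (hit_nonneg o n) hS
    obtain ⟨T₂, hST₂, hT₂⟩ := exists_superset_neighbors (G := G) S
    have hgreen := green (T := T₁ ∪ T₂) (hST₂.trans Finset.subset_union_right)
      (fun v hv w hw => Finset.mem_union_right _ (hT₂ v hv w hw)) f f hS
    have hmono : ∑ v ∈ T₁, ∑ w ∈ G.neighborFinset v, (f v - f w) ^ 2 ≤
        ∑ v ∈ T₁ ∪ T₂, ∑ w ∈ G.neighborFinset v, (f v - f w) * (f v - f w) := by
      simp_rw [← pow_two]
      exact Finset.sum_le_sum_of_subset_of_nonneg Finset.subset_union_left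
        fun v _ _ => Finset.sum_nonneg fun w _ => sq_nonneg _
    have ho : f o = 1 := hit_self o n
    have hsub : ∀ v, v ≠ o → ∑ w ∈ G.neighborFinset v, (f v - f w) ≤ 0 := by
      intro v hv
      simp only [Finset.sum_sub_distrib, Finset.sum_const, G.card_neighborFinset_eq_degree,
        nsmul_eq_mul, sub_nonpos]
      have h1 := hit_le_succ (G := G) o n v
      rw [hit, if_neg hv] at h1
      rcases Nat.eq_zero_or_pos (G.degree v) with h0 | h0
      · rw [h0]
        simpa using Finset.sum_nonneg fun w _ => hit_nonneg o n w
      · rwa [le_div_iff₀' (by exact_mod_cast h0)] at h1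
    have hup : ∑ v ∈ S, f v * ∑ w ∈ G.neighborFinset v, (f v - f w) ≤
        ∑ w ∈ G.neighborFinset o, (f o - f w) := by
      have hoS : o ∈ S := by
        by_contra hoS
        exact one_ne_zero (ho.symm.trans (hS o hoS))
      rw [← Finset.add_sum_erase _ _ hoS, ho, one_mul]
      have : ∑ v ∈ S.erase o, f v * ∑ w ∈ G.neighborFinset v, (f v - f w) ≤ 0 :=
        Finset.sum_nonpos fun v hv =>
          mul_nonpos_of_nonneg_of_nonpos (hit_nonneg o n v) (hsub v (Finset.ne_of_mem_erase hv))
      linarith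
    have hrhs : ∑ w ∈ G.neighborFinset o, (f o - f w) =
        G.degree o - ∑ w ∈ G.neighborFinset o, f w := by
      simp [ho]
    rw [ho] at hT₁
    linarith
  have hd : 0 < G.degree o := by
    by_contra hd
    have hN : G.neighborFinset o = ∅ := by
      rw [← Finset.card_eq_zero, G.card_neighborFinset_eq_degree]; omega
    have := main 0
    rw [hN, Nat.eq_zero_of_not_pos hd] at this
    norm_num at this
    linarith
  have hd' : (0 : ℝ) < G.degree o := by exact_mod_cast hd
  refine ⟨o, (returnProb_le_of_forall hd (p := 1 - c / (2 * G.degree o)) fun n => ?_).trans_lt ?_⟩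
  · rw [div_le_iff₀ hd']
    have h2 : (1 - c / (2 * G.degree o)) * G.degree o = G.degree o - c / 2 := by
      field_simp
    rw [h2]
    linarith [main n]
  · rw [← ENNReal.ofReal_one, ENNReal.ofReal_lt_ofReal_iff one_pos]
    have : 0 < c / (2 * G.degree o) := by positivity
    linarith

end Graph

/-! ### Summability from transience of the wedge -/

/-- The product of a nonnegative summable antitone sequence with the index tends to zero. -/
theorem tendsto_mul_of_antitone_summable {f : ℕ → ℝ} (hf : Antitone f) (hs : Summable f) :
    Filter.Tendsto (fun k : ℕ => (k : ℝ) * f k) Filter.atTop (nhds 0) := by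
  have h0 : ∀ k, 0 ≤ f k := fun k => hf.le_of_tendsto hs.tendsto_atTop_zero k
  have h1 := hs.hasSum.tendsto_sum_nat
  have h2 := h1.comp (Nat.tendsto_div_const_atTop (n := 2) (by norm_num))
  have h3 : Filter.Tendsto (fun k : ℕ => 2 * (∑ i ∈ Finset.range k, f i -
      ∑ i ∈ Finset.range (k / 2), f i)) Filter.atTop (nhds 0) := by
    simpa using (h1.sub h2).const_mul 2
  refine squeeze_zero (fun k => mul_nonneg (Nat.cast_nonneg k) (h0 k)) (fun k => ?_) h3
  rw [← Finset.sum_Ico_eq_sub _ (Nat.div_le_self k 2)]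
  have h4 : ((k - k / 2 : ℕ) : ℝ) * f k ≤ ∑ i ∈ Finset.Ico (k / 2) k, f i := by
    have := Finset.card_nsmul_le_sum (Finset.Ico (k / 2) k) f (f k)
      fun i hi => hf (Finset.mem_Ico.1 hi).2.le
    simpa using this
  have h5 : (k : ℝ) ≤ 2 * ((k - k / 2 : ℕ) : ℝ) := by
    have : k ≤ 2 * (k - k / 2) := by omega
    exact_mod_cast this
  calc (k : ℝ) * f k ≤ 2 * ((k - k / 2 : ℕ) : ℝ) * f k :=
        mul_le_mul_of_nonneg_right h5 (h0 k)
    _ ≤ _ := by linarith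

/-- The `ℓ¹`-norm of the first two coordinates. -/
def radius (p : ℤ × ℤ × ℤ) : ℕ := p.1.natAbs + p.2.1.natAbs

/-- The height of the wedge at abscissa `n`, rounded down. -/
noncomputable def height (h : ℝ → ℝ) (n : ℕ) : ℕ := ⌊h n⌋₊

theorem height_monotone {h : ℝ → ℝ} (hmono : MonotoneOn h (Set.Ici 0)) : Monotone (height h) :=
  fun m n hmn => Nat.floor_mono (hmono (by simp) (by simp) (by exact_mod_cast hmn))

theorem mem_wedge_bounds {h : ℝ → ℝ} (hmono : MonotoneOn h (Set.Ici 0)) {p : ℤ × ℤ × ℤ}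
    (hp : p ∈ wedge h) {n : ℕ} (hn : radius p ≤ n) :
    0 ≤ p.1 ∧ p.1 ≤ n ∧ |p.2.1| ≤ n ∧ |p.2.2| ≤ height h n := by
  obtain ⟨hx, hz⟩ := hp
  unfold radius at hn
  refine ⟨hx, by omega, by rw [Int.abs_eq_natAbs]; omega, ?_⟩
  have hxn : (p.1 : ℝ) ≤ n := by
    have : p.1 ≤ (n : ℤ) := by omega
    exact_mod_cast this
  have h1 : h p.1 ≤ h n := hmono (by simpa using hx) (by simp) hxn
  have h2 : ((p.2.2.natAbs : ℕ) : ℝ) ≤ h n := by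
    rw [Nat.cast_natAbs]; push_cast; exact hz.trans h1
  have h3 := Nat.le_floor h2
  unfold height
  rw [Int.abs_eq_natAbs]
  omega

theorem card_radius_eq_le {h : ℝ → ℝ} (hmono : MonotoneOn h (Set.Ici 0))
    (S : Finset (wedge h)) (n : ℕ) :
    (S.filter fun v => radius v.1 = n).card ≤ (2 * n + 1) * (2 * height h n + 1) := by
  have hcard : (Finset.Icc (-(n : ℤ)) n ×ˢ
      Finset.Icc (-(height h n : ℤ)) (height h n)).card = (2 * n + 1) * (2 * height h n + 1) := by
    rw [Finset.card_product, Int.card_Icc, Int.card_Icc]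
    congr 1 <;> omega
  rw [← hcard]
  refine Finset.card_le_card_of_injOn (fun v => v.1.2) (fun v hv => ?_) fun v hv w hw hvw => ?_
  · obtain ⟨-, -, hy, hz⟩ := mem_wedge_bounds hmono v.2 (Finset.mem_filter.1 hv).2.le
    rw [abs_le] at hy hz
    simp only [Finset.coe_product, Finset.coe_Icc, Set.mem_prod, Set.mem_Icc]
    exact ⟨hy, hz⟩
  · have hv' := (Finset.mem_filter.1 hv).2
    have hw' := (Finset.mem_filter.1 hw).2
    have hv0 := v.2.1
    have hw0 := w.2.1
    simp only at hvw
    unfold radius at hv' hw'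
    rw [hvw] at hv'
    exact Subtype.ext (Prod.ext (by omega) hvw)

theorem finite_radius_lt {h : ℝ → ℝ} (hmono : MonotoneOn h (Set.Ici 0)) (n : ℕ) :
    {v : wedge h | radius v.1 < n}.Finite := by
  refine Set.Finite.of_finite_image (f := Subtype.val) ?_ Subtype.val_injective.injOn
  refine (Set.finite_Icc ((0, -n, -height h n) : ℤ × ℤ × ℤ) (n, n, height h n)).subset ?_
  rintro _ ⟨v, hv, rfl⟩
  obtain ⟨h1, h2, h3, h4⟩ := mem_wedge_bounds hmono v.2 (le_of_lt hv)
  rw [abs_le] at h3 h4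
  exact ⟨⟨h1, h3.1, h4.1⟩, ⟨h2, h3.2, h4.2⟩⟩

theorem card_neighborFinset_lattice_induce_le (A : Set (ℤ × ℤ × ℤ)) (v : A) :
    ((lattice.induce A).neighborFinset v).card ≤ 27 := by
  obtain ⟨⟨x, y, z⟩, hv⟩ := v
  have hcard : (Finset.Icc (x - 1) (x + 1) ×ˢ Finset.Icc (y - 1) (y + 1) ×ˢ
      Finset.Icc (z - 1) (z + 1)).card = 27 := by
    simp only [Finset.card_product, Int.card_Icc]
    ring_nf
    rfl
  rw [← hcard]
  refine Finset.card_le_card_of_injOn Subtype.val ?_ Subtype.val_injective.injOn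
  rintro ⟨⟨x', y', z'⟩, hw⟩ hvw
  have h1 : |x - x'| + |y - y'| + |z - z'| = 1 := by
    have : lattice.Adj (x, y, z) (x', y', z') := by simpa using hvw
    exact this
  simp only [Finset.coe_product, Finset.coe_Icc, Set.mem_prod, Set.mem_Icc]
  grind

theorem radius_le_of_adj {p q : ℤ × ℤ × ℤ} (h : lattice.Adj p q) : radius q ≤ radius p + 1 := by
  have h1 : |p.1 - q.1| + |p.2.1 - q.2.1| + |p.2.2 - q.2.2| = 1 := h
  unfold radius
  grind

/-- The order of the electrical resistance between the vertices of radius `n` and those of radius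
`n + 1`: the wedge has at most `4 / resistance h n` vertices of radius `n`. -/
noncomputable def resistance (h : ℝ → ℝ) (n : ℕ) : ℝ := 1 / ((n + 1) * (height h n + 1))

theorem resistance_nonneg (h : ℝ → ℝ) (n : ℕ) : 0 ≤ resistance h n := by
  unfold resistance; positivity

theorem resistance_antitone {h : ℝ → ℝ} (hmono : MonotoneOn h (Set.Ici 0)) :
    Antitone (resistance h) := by
  intro m n hmn
  have := height_monotone hmono hmn
  unfold resistance
  gcongr

/-- The energy of the radial function whose increments are the numbers `resistance h n`. -/
theorem energy_radial_le {h : ℝ → ℝ} (hmono : MonotoneOn h (Set.Ici 0)) (N : ℕ) :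
    ∑ v ∈ (finite_radius_lt hmono N).toFinset,
      ∑ w ∈ (lattice.induce (wedge h)).neighborFinset v,
        (max (∑ m ∈ Finset.Ico (radius v.1) N, resistance h m -
          ∑ m ∈ Finset.Ico (radius w.1) N, resistance h m) 0) ^ 2 ≤
      108 * ∑ n ∈ Finset.range N, resistance h n := by
  have hr := resistance_nonneg h
  set S := (finite_radius_lt hmono N).toFinset with hS
  have h1 : ∀ v ∈ S, ∑ w ∈ (lattice.induce (wedge h)).neighborFinset v,
        (max (∑ m ∈ Finset.Ico (radius v.1) N, resistance h m -
          ∑ m ∈ Finset.Ico (radius w.1) N, resistance h m) 0) ^ 2 ≤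
        27 * resistance h (radius v.1) ^ 2 := by
    intro v hv
    have hvN : radius v.1 < N := by simpa [hS] using hv
    calc _ ≤ ∑ w ∈ (lattice.induce (wedge h)).neighborFinset v, resistance h (radius v.1) ^ 2 := by
          refine Finset.sum_le_sum fun w hw => ?_
          have hvw : radius w.1 ≤ radius v.1 + 1 := radius_le_of_adj (by simpa using hw)
          refine pow_le_pow_left₀ (le_max_right _ _) (max_le ?_ (hr _)) 2
          rw [Finset.sum_eq_sum_Ico_succ_bot hvN]
          have := Finset.sum_le_sum_of_subset_of_nonneg (Finset.Ico_subset_Ico_left (b := N) hvw)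
            fun m _ _ => hr m
          linarith
      _ ≤ _ := by
          rw [Finset.sum_const, nsmul_eq_mul]
          have : (((lattice.induce (wedge h)).neighborFinset v).card : ℝ) ≤ 27 := by
            exact_mod_cast card_neighborFinset_lattice_induce_le _ v
          gcongr
  refine (Finset.sum_le_sum h1).trans ?_
  rw [← Finset.sum_fiberwise_of_maps_to (s := S) (t := Finset.range N) (g := fun v => radius v.1)
    (fun v hv => by simpa [hS] using hv), Finset.mul_sum]
  refine Finset.sum_le_sum fun n _ => ?_
  calc ∑ v ∈ S with radius v.1 = n, 27 * resistance h (radius v.1) ^ 2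
      = ∑ v ∈ S with radius v.1 = n, 27 * resistance h n ^ 2 :=
        Finset.sum_congr rfl fun v hv => by rw [(Finset.mem_filter.1 hv).2]
    _ = ((S.filter fun v => radius v.1 = n).card : ℝ) * (27 * resistance h n ^ 2) := by
        rw [Finset.sum_const, nsmul_eq_mul]
    _ ≤ (4 * ((n + 1) * (height h n + 1))) * (27 * resistance h n ^ 2) := by
        gcongr
        have h2 : ((S.filter fun v => radius v.1 = n).card : ℝ) ≤
            (2 * n + 1) * (2 * height h n + 1) := by exact_mod_cast card_radius_eq_le hmono S n
        refine h2.trans ?_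
        have : (0 : ℝ) ≤ n := Nat.cast_nonneg n
        have : (0 : ℝ) ≤ height h n := Nat.cast_nonneg _
        nlinarith
    _ = 108 * resistance h n := by
        unfold resistance
        field_simp
        norm_num

/-- The Nash-Williams criterion for wedges. -/
theorem summable_resistance {h : ℝ → ℝ} (hmono : MonotoneOn h (Set.Ici 0))
    (htrans : Transient (lattice.induce (wedge h))) : Summable (resistance h) := by
  obtain ⟨o, c, hc, hcap⟩ := htrans.exists_le_energy
  have hr := resistance_nonneg h
  set s : ℕ → ℝ := fun N => ∑ n ∈ Finset.range N, resistance h n with hs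
  have hs0 : ∀ N, 0 ≤ s N := fun N => Finset.sum_nonneg fun n _ => hr n
  set R := radius o.1 with hR
  have key : ∀ N, R ≤ N → c * (s N - s R) ^ 2 ≤ 108 * s N := by
    intro N hN
    refine le_trans ?_ (energy_radial_le hmono N)
    have := hcap (fun v => ∑ m ∈ Finset.Ico (radius v.1) N, resistance h m)
      (finite_radius_lt hmono N).toFinset (fun v => Finset.sum_nonneg fun m _ => hr m) fun v hv => by
        rw [Finset.Ico_eq_empty_of_le (by simpa using hv), Finset.sum_empty]
    rwa [Finset.sum_Ico_eq_sub _ hN] at this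
  refine summable_of_sum_range_le (c := s R + 1 + 108 * (1 + s R) / c) hr fun N => ?_
  have hmonoS : s N ≤ s (max N R) := Finset.sum_le_sum_of_subset_of_nonneg
    (Finset.range_subset_range.2 (le_max_left _ _)) fun m _ _ => hr m
  refine hmonoS.trans ?_
  have hk := key (max N R) (le_max_right _ _)
  set t := s (max N R) - s R with ht
  have hpos : 0 ≤ 108 * (1 + s R) / c := by have := hs0 R; positivity
  rcases le_total t 1 with h1 | h1
  · linarith
  · have h2 : c * t * t ≤ 108 * (1 + s R) * t := by nlinarith [hs0 R]
    have h3 : c * t ≤ 108 * (1 + s R) := le_of_mul_le_mul_right h2 (by linarith)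
    have h4 : t ≤ 108 * (1 + s R) / c := by rw [le_div_iff₀ hc]; linarith
    linarith

theorem summable_inv_height {h : ℝ → ℝ} (hmono : MonotoneOn h (Set.Ici 0))
    (htrans : Transient (lattice.induce (wedge h))) :
    Summable fun k : ℕ => 1 / ((height h (2 ^ k) : ℝ) + 1) := by
  have h1 := (summable_condensed_iff_of_nonneg (resistance_nonneg h)
    fun _ _ _ hmn => resistance_antitone hmono hmn).2 (summable_resistance hmono htrans)
  refine Summable.of_nonneg_of_le (fun k => by positivity) (fun k => ?_) (h1.mul_left 2)
  have h2 : (1 : ℝ) ≤ 2 ^ k := one_le_pow₀ (by norm_num)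
  unfold resistance
  push_cast
  rw [mul_one_div, mul_div_assoc', div_le_div_iff₀ (by positivity) (by positivity)]
  have : (0 : ℝ) ≤ height h (2 ^ k) := Nat.cast_nonneg _
  nlinarith

/-! ### Averages over dyadic boxes -/

theorem abs_avg_sub_le {ι : Type*} {I : Finset ι} (hI : I.Nonempty) {φ : ι → ℝ} {c D : ℝ}
    (h : ∀ i ∈ I, |φ i - c| ≤ D) : |(∑ i ∈ I, φ i) / I.card - c| ≤ D := by
  have hpos : (0 : ℝ) < I.card := by exact_mod_cast hI.card_pos
  have h1 : (∑ i ∈ I, φ i) / I.card - c = (∑ i ∈ I, (φ i - c)) / I.card := by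
    rw [Finset.sum_sub_distrib, Finset.sum_const, nsmul_eq_mul]
    field_simp
  rw [h1, abs_div, Nat.abs_cast, div_le_iff₀ hpos]
  calc |∑ i ∈ I, (φ i - c)| ≤ ∑ i ∈ I, |φ i - c| := Finset.abs_sum_le_sum_abs _ _
    _ ≤ ∑ i ∈ I, D := Finset.sum_le_sum h
    _ = D * I.card := by rw [Finset.sum_const, nsmul_eq_mul, mul_comm]

theorem abs_sub_le_sum_increments (φ : ℕ → ℝ) {a b i j : ℕ} (hi : i ∈ Finset.Ico a b)
    (hj : j ∈ Finset.Ico a b) :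
    |φ i - φ j| ≤ ∑ t ∈ Finset.Ico a (b - 1), |φ (t + 1) - φ t| := by
  wlog hij : j ≤ i generalizing i j
  · rw [abs_sub_comm]
    exact this hj hi (le_of_not_ge hij)
  rw [Finset.mem_Ico] at hi hj
  rw [← Finset.sum_Ico_sub φ hij]
  refine (Finset.abs_sum_le_sum_abs _ _).trans ?_
  exact Finset.sum_le_sum_of_subset_of_nonneg (Finset.Ico_subset_Ico (by omega) (by omega))
    fun t _ _ => abs_nonneg _

theorem sq_avg_sub_avg_le (φ : ℕ → ℝ) {a b : ℕ} {I J : Finset ℕ} (hI : I.Nonempty)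
    (hJ : J.Nonempty) (hIab : I ⊆ Finset.Ico a b) (hJab : J ⊆ Finset.Ico a b) :
    ((∑ i ∈ I, φ i) / I.card - (∑ j ∈ J, φ j) / J.card) ^ 2 ≤
      ((b - a : ℕ) : ℝ) * ∑ t ∈ Finset.Ico a (b - 1), (φ (t + 1) - φ t) ^ 2 := by
  have h1 : |(∑ i ∈ I, φ i) / I.card - (∑ j ∈ J, φ j) / J.card| ≤
      ∑ t ∈ Finset.Ico a (b - 1), |φ (t + 1) - φ t| := by
    refine abs_avg_sub_le hI fun i hi => ?_
    rw [abs_sub_comm]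
    exact abs_avg_sub_le hJ fun j hj => abs_sub_le_sum_increments φ (hJab hj) (hIab hi)
  calc ((∑ i ∈ I, φ i) / I.card - (∑ j ∈ J, φ j) / J.card) ^ 2
      ≤ (∑ t ∈ Finset.Ico a (b - 1), |φ (t + 1) - φ t|) ^ 2 := by
        rw [← sq_abs]
        exact pow_le_pow_left₀ (abs_nonneg _) h1 2
    _ ≤ (Finset.Ico a (b - 1)).card * ∑ t ∈ Finset.Ico a (b - 1), |φ (t + 1) - φ t| ^ 2 :=
        sq_sum_le_card_mul_sum_sq
    _ ≤ _ := by
        simp_rw [sq_abs]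
        refine mul_le_mul_of_nonneg_right ?_ (Finset.sum_nonneg fun t _ => sq_nonneg _)
        rw [Nat.card_Ico]
        exact_mod_cast (by omega : b - 1 - a ≤ b - a)

/-- Moving one side of a box changes the average of a function by an amount controlled by the
energy of the edges in the direction of the move. -/
theorem sq_avg_prod_sub_le {ι : Type*} (Φ : ℕ → ι → ℝ) {Y : Finset ι} (hY : Y.Nonempty) {a b : ℕ}
    {I J : Finset ℕ} (hI : I.Nonempty) (hJ : J.Nonempty) (hIab : I ⊆ Finset.Ico a b)
    (hJab : J ⊆ Finset.Ico a b) :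
    ((∑ y ∈ Y, ∑ i ∈ I, Φ i y) / (I.card * Y.card) -
        (∑ y ∈ Y, ∑ j ∈ J, Φ j y) / (J.card * Y.card)) ^ 2 ≤
      ((b - a : ℕ) : ℝ) / Y.card *
        ∑ y ∈ Y, ∑ t ∈ Finset.Ico a (b - 1), (Φ (t + 1) y - Φ t y) ^ 2 := by
  have hpos : (0 : ℝ) < Y.card := by exact_mod_cast hY.card_pos
  set d : ι → ℝ := fun y => (∑ i ∈ I, Φ i y) / I.card - (∑ j ∈ J, Φ j y) / J.card with hd
  have h1 : (∑ y ∈ Y, ∑ i ∈ I, Φ i y) / (I.card * Y.card) -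
      (∑ y ∈ Y, ∑ j ∈ J, Φ j y) / (J.card * Y.card) = (∑ y ∈ Y, d y) / Y.card := by
    rw [hd, Finset.sum_sub_distrib, ← Finset.sum_div, ← Finset.sum_div, sub_div, div_div, div_div]
  have h2 : ∑ y ∈ Y, d y ^ 2 ≤ ((b - a : ℕ) : ℝ) *
      ∑ y ∈ Y, ∑ t ∈ Finset.Ico a (b - 1), (Φ (t + 1) y - Φ t y) ^ 2 := by
    rw [Finset.mul_sum]
    exact Finset.sum_le_sum fun y _ => sq_avg_sub_avg_le (fun i => Φ i y) hI hJ hIab hJab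
  have h3 : (∑ y ∈ Y, d y) ^ 2 ≤ Y.card * ∑ y ∈ Y, d y ^ 2 := sq_sum_le_card_mul_sum_sq
  rw [h1, div_pow, div_le_iff₀ (by positivity)]
  calc (∑ y ∈ Y, d y) ^ 2 ≤ Y.card * (((b - a : ℕ) : ℝ) *
      ∑ y ∈ Y, ∑ t ∈ Finset.Ico a (b - 1), (Φ (t + 1) y - Φ t y) ^ 2) := h3.trans (by gcongr)
    _ = _ := by field_simp

/-- The average of `F` over the box `X × Y × Z`. -/
noncomputable def boxAvg (F : ℕ × ℕ × ℕ → ℝ) (X Y Z : Finset ℕ) : ℝ :=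
  (∑ x ∈ X, ∑ y ∈ Y, ∑ z ∈ Z, F (x, y, z)) / (X.card * Y.card * Z.card)

section

variable (F e : ℕ × ℕ × ℕ → ℝ) {X Y Z I J : Finset ℕ} {a b : ℕ}

theorem sq_boxAvg_sub_fst_le (hY : Y.Nonempty) (hZ : Z.Nonempty) (hI : I.Nonempty)
    (hJ : J.Nonempty) (hIab : I ⊆ Finset.Ico a b) (hJab : J ⊆ Finset.Ico a b)
    (he : ∀ x ∈ Finset.Ico a (b - 1), ∀ y ∈ Y, ∀ z ∈ Z,
      (F (x + 1, y, z) - F (x, y, z)) ^ 2 ≤ e (x, y, z)) :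
    (boxAvg F I Y Z - boxAvg F J Y Z) ^ 2 ≤ ((b - a : ℕ) : ℝ) / (Y.card * Z.card) *
      ∑ p ∈ Finset.Ico a (b - 1) ×ˢ Y ×ˢ Z, e p := by
  have h := sq_avg_prod_sub_le (fun x (p : ℕ × ℕ) => F (x, p)) (hY.product hZ) hI hJ hIab hJab
  have hav : ∀ I : Finset ℕ, boxAvg F I Y Z =
      (∑ p ∈ Y ×ˢ Z, ∑ i ∈ I, F (i, p)) / (I.card * (Y ×ˢ Z).card) := by
    intro I
    rw [boxAvg, Finset.card_product, Nat.cast_mul, mul_assoc, Finset.sum_comm (s := Y ×ˢ Z)]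
    simp_rw [Finset.sum_product]
  rw [hav, hav]
  refine h.trans ?_
  rw [Finset.card_product, Nat.cast_mul, Finset.sum_product_right (s := Finset.Ico a (b - 1))]
  refine mul_le_mul_of_nonneg_left (Finset.sum_le_sum fun p hp => ?_) (by positivity)
  obtain ⟨hy, hz⟩ := Finset.mem_product.1 hp
  exact Finset.sum_le_sum fun x hx => he x hx p.1 hy p.2 hz

theorem sq_boxAvg_sub_snd_le (hX : X.Nonempty) (hZ : Z.Nonempty) (hI : I.Nonempty)
    (hJ : J.Nonempty) (hIab : I ⊆ Finset.Ico a b) (hJab : J ⊆ Finset.Ico a b)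
    (he : ∀ x ∈ X, ∀ y ∈ Finset.Ico a (b - 1), ∀ z ∈ Z,
      (F (x, y + 1, z) - F (x, y, z)) ^ 2 ≤ e (x, y, z)) :
    (boxAvg F X I Z - boxAvg F X J Z) ^ 2 ≤ ((b - a : ℕ) : ℝ) / (X.card * Z.card) *
      ∑ p ∈ X ×ˢ Finset.Ico a (b - 1) ×ˢ Z, e p := by
  have h := sq_avg_prod_sub_le (fun y (p : ℕ × ℕ) => F (p.1, y, p.2)) (hX.product hZ) hI hJ
    hIab hJab
  have hav : ∀ I : Finset ℕ, boxAvg F X I Z =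
      (∑ p ∈ X ×ˢ Z, ∑ i ∈ I, F (p.1, i, p.2)) / (I.card * (X ×ˢ Z).card) := by
    intro I
    rw [boxAvg, Finset.card_product, Nat.cast_mul, Finset.sum_product]
    congr 1
    · exact Finset.sum_congr rfl fun x _ => Finset.sum_comm
    · ring
  rw [hav, hav]
  refine h.trans ?_
  rw [Finset.card_product, Nat.cast_mul, Finset.sum_product, Finset.sum_product]
  refine mul_le_mul_of_nonneg_left (Finset.sum_le_sum fun x hx => ?_) (by positivity)
  rw [Finset.sum_product_right]
  exact Finset.sum_le_sum fun z hz => Finset.sum_le_sum fun y hy => he x hx y hy z hz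

theorem sq_boxAvg_sub_trd_le (hX : X.Nonempty) (hY : Y.Nonempty) (hI : I.Nonempty)
    (hJ : J.Nonempty) (hIab : I ⊆ Finset.Ico a b) (hJab : J ⊆ Finset.Ico a b)
    (he : ∀ x ∈ X, ∀ y ∈ Y, ∀ z ∈ Finset.Ico a (b - 1),
      (F (x, y, z + 1) - F (x, y, z)) ^ 2 ≤ e (x, y, z)) :
    (boxAvg F X Y I - boxAvg F X Y J) ^ 2 ≤ ((b - a : ℕ) : ℝ) / (X.card * Y.card) *
      ∑ p ∈ X ×ˢ Y ×ˢ Finset.Ico a (b - 1), e p := by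
  have h := sq_avg_prod_sub_le (fun z (p : ℕ × ℕ) => F (p.1, p.2, z)) (hX.product hY) hI hJ
    hIab hJab
  have hav : ∀ I : Finset ℕ, boxAvg F X Y I =
      (∑ p ∈ X ×ˢ Y, ∑ i ∈ I, F (p.1, p.2, i)) / (I.card * (X ×ˢ Y).card) := by
    intro I
    rw [boxAvg, Finset.card_product, Nat.cast_mul, Finset.sum_product]
    congr 1
    ring
  rw [hav, hav]
  refine h.trans ?_
  rw [Finset.card_product, Nat.cast_mul, Finset.sum_product, Finset.sum_product]
  refine mul_le_mul_of_nonneg_left (Finset.sum_le_sum fun x hx => ?_) (by positivity)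
  rw [Finset.sum_product]
  exact Finset.sum_le_sum fun y hy => Finset.sum_le_sum fun z hz => he x hx y hy z hz

end

/-- The average of `F` over the `k`-th box `[2 ^ k, 2 ^ (k + 1)) × [0, 2 ^ k) × [0, G k)`. -/
noncomputable def dyadicAvg (F : ℕ × ℕ × ℕ → ℝ) (G : ℕ → ℕ) (k : ℕ) : ℝ :=
  boxAvg F (Finset.Ico (2 ^ k) (2 ^ (k + 1))) (Finset.range (2 ^ k)) (Finset.range (G k))

/-- The box `[2 ^ k, 2 ^ (k + 2)) × [0, 2 ^ (k + 1)) × [0, G (k + 1))`, which contains the boxes of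
index `k` and `k + 1`. -/
def dyadicHull (G : ℕ → ℕ) (k : ℕ) : Finset (ℕ × ℕ × ℕ) :=
  Finset.Ico (2 ^ k) (2 ^ (k + 2)) ×ˢ Finset.range (2 ^ (k + 1)) ×ˢ Finset.range (G (k + 1))

/-- Consecutive averages are compared by moving one side of the box at a time; all the boxes met on
the way have height at most `G k` over abscissas in `[2 ^ k, 2 ^ (k + 2))`, or at most `G (k + 1)`
over abscissas in `[2 ^ (k + 1), 2 ^ (k + 2))`. Here `A` is the region over which `F` is
controlled, and `e p` bounds the squared increments of `F` along the edges of `A` starting at `p`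
in the positive directions. -/
theorem sq_dyadicAvg_sub_le {F e : ℕ × ℕ × ℕ → ℝ} (he0 : ∀ p, 0 ≤ e p) {G : ℕ → ℕ}
    (hG : Monotone G) (hG1 : ∀ k, 1 ≤ G k) (hG2 : ∀ k, G k ≤ 2 ^ k) {A : Set (ℕ × ℕ × ℕ)}
    (hx : ∀ x y z, (x, y, z) ∈ A → (x + 1, y, z) ∈ A →
      (F (x + 1, y, z) - F (x, y, z)) ^ 2 ≤ e (x, y, z))
    (hy : ∀ x y z, (x, y, z) ∈ A → (x, y + 1, z) ∈ A →
      (F (x, y + 1, z) - F (x, y, z)) ^ 2 ≤ e (x, y, z))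
    (hz : ∀ x y z, (x, y, z) ∈ A → (x, y, z + 1) ∈ A →
      (F (x, y, z + 1) - F (x, y, z)) ^ 2 ≤ e (x, y, z)) {k : ℕ}
    (hA : ∀ j, k ≤ j → ∀ x y z, 2 ^ j ≤ x → x < 2 ^ (j + 2) → y < 2 ^ (j + 1) → z < G j →
      (x, y, z) ∈ A) :
    (dyadicAvg F G k - dyadicAvg F G (k + 1)) ^ 2 ≤
      15 / G k * ∑ p ∈ dyadicHull G k, e p := by
  have hp1 : 2 ^ (k + 1) = 2 * 2 ^ k := by ring
  have hp2 : 2 ^ (k + 2) = 4 * 2 ^ k := by ring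
  have hp3 : 2 ^ (k + 3) = 8 * 2 ^ k := by ring
  have hL : 0 < 2 ^ k := by positivity
  have hGk := hG1 k
  have hGs := hG (Nat.le_succ k)
  have hG' := hG2 (k + 1)
  have hGk2 := hG2 k
  rw [Nat.succ_eq_add_one] at hGs
  set X₀ := Finset.Ico (2 ^ k) (2 ^ (k + 1)) with hX₀
  set X₁ := Finset.Ico (2 ^ (k + 1)) (2 ^ (k + 1 + 1)) with hX₁
  set Y₀ := Finset.range (2 ^ k) with hY₀
  set Y₁ := Finset.range (2 ^ (k + 1)) with hY₁
  set Z₀ := Finset.range (G k) with hZ₀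
  set Z₁ := Finset.range (G (k + 1)) with hZ₁
  have nX₀ : X₀.Nonempty := Finset.nonempty_Ico.2 (by omega)
  have nX₁ : X₁.Nonempty := Finset.nonempty_Ico.2 (by omega)
  have nY₀ : Y₀.Nonempty := Finset.nonempty_range_iff.2 (by omega)
  have nY₁ : Y₁.Nonempty := Finset.nonempty_range_iff.2 (by omega)
  have nZ₀ : Z₀.Nonempty := Finset.nonempty_range_iff.2 (by omega)
  have nZ₁ : Z₁.Nonempty := Finset.nonempty_range_iff.2 (by omega)
  set W := ∑ p ∈ dyadicHull G k, e p with hW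
  have hW0 : 0 ≤ W := Finset.sum_nonneg fun p _ => he0 p
  have hsub : ∀ {s : Finset (ℕ × ℕ × ℕ)}, s ⊆ dyadicHull G k → ∑ p ∈ s, e p ≤ W :=
    fun hs => Finset.sum_le_sum_of_subset_of_nonneg hs fun p _ _ => he0 p
  have sx := sq_boxAvg_sub_fst_le F e (a := 2 ^ k) (b := 2 ^ (k + 2)) nY₀ nZ₀ nX₀ nX₁
    (Finset.Ico_subset_Ico le_rfl (by omega)) (Finset.Ico_subset_Ico (by omega) le_rfl)
    fun x hx' y hy' z hz' => by
      simp only [hY₀, hZ₀, Finset.mem_Ico, Finset.mem_range] at hx' hy' hz'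
      exact hx x y z (hA k le_rfl _ _ _ (by omega) (by omega) (by omega) (by omega))
        (hA k le_rfl _ _ _ (by omega) (by omega) (by omega) (by omega))
  have sy := sq_boxAvg_sub_snd_le F e (a := 0) (b := 2 ^ (k + 1)) nX₁ nZ₀ nY₀ nY₁
    (by rw [hY₀, Finset.range_eq_Ico]; exact Finset.Ico_subset_Ico le_rfl (by omega))
    (by rw [hY₁, Finset.range_eq_Ico])
    fun x hx' y hy' z hz' => by
      simp only [hX₁, hZ₀, Finset.mem_Ico, Finset.mem_range] at hx' hy' hz'
      exact hy x y z (hA k le_rfl _ _ _ (by omega) (by omega) (by omega) (by omega))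
        (hA k le_rfl _ _ _ (by omega) (by omega) (by omega) (by omega))
  have sz := sq_boxAvg_sub_trd_le F e (a := 0) (b := G (k + 1)) nX₁ nY₁ nZ₀ nZ₁
    (by rw [hZ₀, Finset.range_eq_Ico]; exact Finset.Ico_subset_Ico le_rfl (by omega))
    (by rw [hZ₁, Finset.range_eq_Ico])
    fun x hx' y hy' z hz' => by
      simp only [hX₁, hY₁, Finset.mem_Ico, Finset.mem_range] at hx' hy' hz'
      have e2 : k + 1 + 2 = k + 3 := by ring
      have e1 : k + 1 + 1 = k + 2 := by ring
      rw [e1] at hx'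
      exact hz x y z
        (hA (k + 1) (by omega) _ _ _ (by omega) (by rw [e2]; omega) (by rw [e1]; omega) (by omega))
        (hA (k + 1) (by omega) _ _ _ (by omega) (by rw [e2]; omega) (by rw [e1]; omega) (by omega))
  have ux : ∑ p ∈ Finset.Ico (2 ^ k) (2 ^ (k + 2) - 1) ×ˢ Y₀ ×ˢ Z₀, e p ≤ W :=
    hsub (Finset.product_subset_product (Finset.Ico_subset_Ico le_rfl (by omega))
      (Finset.product_subset_product (Finset.range_subset_range.2 (by omega))
        (Finset.range_subset_range.2 hGs)))
  have uy : ∑ p ∈ X₁ ×ˢ Finset.Ico 0 (2 ^ (k + 1) - 1) ×ˢ Z₀, e p ≤ W :=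
    hsub (Finset.product_subset_product (Finset.Ico_subset_Ico (by omega) le_rfl)
      (Finset.product_subset_product
        (by rw [Finset.range_eq_Ico]; exact Finset.Ico_subset_Ico le_rfl (by omega))
        (Finset.range_subset_range.2 hGs)))
  have uz : ∑ p ∈ X₁ ×ˢ Y₁ ×ˢ Finset.Ico 0 (G (k + 1) - 1), e p ≤ W :=
    hsub (Finset.product_subset_product (Finset.Ico_subset_Ico (by omega) le_rfl)
      (Finset.product_subset_product subset_rfl
        (by rw [Finset.range_eq_Ico]; exact Finset.Ico_subset_Ico le_rfl (by omega))))
  have cX₁ : X₁.card = 2 * 2 ^ k := by rw [hX₁, Nat.card_Ico]; omega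
  have cY₀ : Y₀.card = 2 ^ k := Finset.card_range _
  have cY₁ : Y₁.card = 2 * 2 ^ k := by rw [hY₁, Finset.card_range]; omega
  have cZ₀ : Z₀.card = G k := Finset.card_range _
  have lx : 2 ^ (k + 2) - 2 ^ k = 3 * 2 ^ k := by omega
  have ly : 2 ^ (k + 1) - 0 = 2 * 2 ^ k := by omega
  rw [lx, cY₀, cZ₀] at sx
  rw [ly, cX₁, cZ₀] at sy
  rw [Nat.sub_zero, cX₁, cY₁] at sz
  push_cast at sx sy sz
  have hL' : (0 : ℝ) < 2 ^ k := by positivity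
  have hg : (0 : ℝ) < G k := by exact_mod_cast hGk
  have hgL : (G k : ℝ) ≤ 2 ^ k := by exact_mod_cast hGk2
  have hg' : (G (k + 1) : ℝ) ≤ 2 * 2 ^ k := by rw [hp1] at hG'; exact_mod_cast hG'
  have hg'0 : (0 : ℝ) ≤ G (k + 1) := Nat.cast_nonneg _
  have tx := sx.trans (mul_le_mul_of_nonneg_left ux (by positivity))
  have ty := sy.trans (mul_le_mul_of_nonneg_left uy (by positivity))
  have tz := sz.trans (mul_le_mul_of_nonneg_left uz (by positivity))
  have qx : 3 * 2 ^ k / (2 ^ k * (G k : ℝ)) = 3 / G k := by field_simp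
  have qy : 2 * 2 ^ k / (2 * 2 ^ k * (G k : ℝ)) = 1 / G k := by field_simp
  have qz : (G (k + 1) : ℝ) / (2 * 2 ^ k * (2 * 2 ^ k)) ≤ 1 / G k := by
    rw [div_le_div_iff₀ (by positivity) hg]
    nlinarith
  rw [qx] at tx
  rw [qy] at ty
  have tz' := tz.trans (mul_le_mul_of_nonneg_right qz hW0)
  -- the three moves cost `3 / G k`, `1 / G k`, `1 / G k`, and `(a + b + c)² ≤ 3 (a² + b² + c²)`
  have hsum : 15 / G k * W = 3 * (3 / G k * W + 1 / G k * W + 1 / G k * W) := by ring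
  rw [hsum]
  unfold dyadicAvg
  set m₀ := boxAvg F X₀ Y₀ Z₀
  set m₁ := boxAvg F X₁ Y₀ Z₀
  set m₂ := boxAvg F X₁ Y₁ Z₀
  set m₃ := boxAvg F X₁ Y₁ Z₁
  nlinarith [sq_nonneg (m₀ - m₁ - (m₁ - m₂)), sq_nonneg (m₀ - m₁ - (m₂ - m₃)),
    sq_nonneg (m₁ - m₂ - (m₂ - m₃))]

theorem sum_dyadicHull_le {e : ℕ × ℕ × ℕ → ℝ} (he0 : ∀ p, 0 ≤ e p) (G : ℕ → ℕ)
    (k₀ K : ℕ) :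
    ∃ P : Finset (ℕ × ℕ × ℕ), ∑ k ∈ Finset.Ico k₀ K, ∑ p ∈ dyadicHull G k, e p ≤
      2 * ∑ p ∈ P, e p := by
  classical
  set P := (Finset.Ico k₀ K).biUnion fun k => dyadicHull G k with hP
  refine ⟨P, ?_⟩
  have h1 : ∀ k ∈ Finset.Ico k₀ K, ∑ p ∈ dyadicHull G k, e p ≤
      ∑ p ∈ P, if 2 ^ k ≤ p.1 ∧ p.1 < 2 ^ (k + 2) then e p else 0 := by
    intro k hk
    rw [← Finset.sum_filter]
    refine Finset.sum_le_sum_of_subset_of_nonneg (fun p hp => ?_) fun p _ _ => he0 p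
    refine Finset.mem_filter.2 ⟨Finset.mem_biUnion.2 ⟨k, hk, hp⟩, ?_⟩
    exact Finset.mem_Ico.1 (Finset.mem_product.1 hp).1
  refine (Finset.sum_le_sum h1).trans ?_
  rw [Finset.sum_comm, Finset.mul_sum]
  refine Finset.sum_le_sum fun p _ => ?_
  rw [← Finset.sum_filter, Finset.sum_const, nsmul_eq_mul]
  refine mul_le_mul_of_nonneg_right ?_ (he0 p)
  -- a point lies over the dyadic ranges of at most two scales
  have h2 : ((Finset.Ico k₀ K).filter fun k => 2 ^ k ≤ p.1 ∧ p.1 < 2 ^ (k + 2)) ⊆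
      {Nat.log 2 p.1, Nat.log 2 p.1 - 1} := by
    intro k hk
    obtain ⟨-, hk1, hk2⟩ := Finset.mem_filter.1 hk
    have h3 := Nat.le_log_of_pow_le (by norm_num) hk1
    have h4 := Nat.log_lt_of_lt_pow (by have := Nat.two_pow_pos k; omega) hk2
    simp only [Finset.mem_insert, Finset.mem_singleton]
    omega
  exact_mod_cast (Finset.card_le_card h2).trans Finset.card_le_two

/-- A finitely supported function is bounded in terms of its energy: the averages over dyadic
boxes telescope to zero, and `∑ 1 / G k` converges. -/
theorem sq_dyadicAvg_le_energy {F e : ℕ × ℕ × ℕ → ℝ} (he0 : ∀ p, 0 ≤ e p) {G : ℕ → ℕ}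
    (hG : Monotone G) (hG1 : ∀ k, 1 ≤ G k) (hG2 : ∀ k, G k ≤ 2 ^ k)
    (hGs : Summable fun k => 1 / (G k : ℝ)) {A : Set (ℕ × ℕ × ℕ)}
    (hx : ∀ x y z, (x, y, z) ∈ A → (x + 1, y, z) ∈ A →
      (F (x + 1, y, z) - F (x, y, z)) ^ 2 ≤ e (x, y, z))
    (hy : ∀ x y z, (x, y, z) ∈ A → (x, y + 1, z) ∈ A →
      (F (x, y + 1, z) - F (x, y, z)) ^ 2 ≤ e (x, y, z))
    (hz : ∀ x y z, (x, y, z) ∈ A → (x, y, z + 1) ∈ A →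
      (F (x, y, z + 1) - F (x, y, z)) ^ 2 ≤ e (x, y, z)) {k₀ : ℕ}
    (hA : ∀ j, k₀ ≤ j → ∀ x y z, 2 ^ j ≤ x → x < 2 ^ (j + 2) → y < 2 ^ (j + 1) → z < G j →
      (x, y, z) ∈ A) {N : ℕ} (hN : ∀ x y z, N ≤ x → F (x, y, z) = 0) :
    ∃ P : Finset (ℕ × ℕ × ℕ),
      dyadicAvg F G k₀ ^ 2 ≤ (30 * ∑' k, 1 / (G k : ℝ)) * ∑ p ∈ P, e p := by
  set K := max k₀ N with hK
  obtain ⟨P, hP⟩ := sum_dyadicHull_le he0 G k₀ K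
  refine ⟨P, ?_⟩
  have hzero : dyadicAvg F G K = 0 := by
    unfold dyadicAvg boxAvg
    rw [Finset.sum_eq_zero, zero_div]
    intro x hx
    refine Finset.sum_eq_zero fun y _ => Finset.sum_eq_zero fun z _ => hN x y z ?_
    have h1 : K < 2 ^ K := Nat.lt_two_pow_self
    have h2 := (Finset.mem_Ico.1 hx).1
    omega
  have htel : dyadicAvg F G k₀ =
      ∑ k ∈ Finset.Ico k₀ K, (dyadicAvg F G k - dyadicAvg F G (k + 1)) := by
    have := Finset.sum_Ico_sub (fun k => dyadicAvg F G k) (le_max_left k₀ N)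
    rw [← hK, hzero] at this
    rw [← neg_inj, ← Finset.sum_neg_distrib]
    simp only [neg_sub]
    linarith
  have hcs : dyadicAvg F G k₀ ^ 2 ≤ (∑ k ∈ Finset.Ico k₀ K, 15 / (G k : ℝ)) *
      ∑ k ∈ Finset.Ico k₀ K, ∑ p ∈ dyadicHull G k, e p := by
    rw [htel]
    refine Finset.sum_sq_le_sum_mul_sum_of_sq_le_mul _ (fun k _ => by positivity)
      (fun k _ => Finset.sum_nonneg fun p _ => he0 p) fun k hk => ?_
    exact sq_dyadicAvg_sub_le he0 hG hG1 hG2 hx hy hz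
      fun j hj => hA j ((Finset.mem_Ico.1 hk).1.trans hj)
  have hsum : ∑ k ∈ Finset.Ico k₀ K, 15 / (G k : ℝ) ≤ 15 * ∑' k, 1 / (G k : ℝ) := by
    have := hGs.sum_le_tsum (Finset.Ico k₀ K) fun k _ => by positivity
    calc ∑ k ∈ Finset.Ico k₀ K, 15 / (G k : ℝ) = 15 * ∑ k ∈ Finset.Ico k₀ K, 1 / (G k : ℝ) := by
          rw [Finset.mul_sum]
          exact Finset.sum_congr rfl fun k _ => by ring
      _ ≤ _ := by linarith
  calc dyadicAvg F G k₀ ^ 2 ≤ (15 * ∑' k, 1 / (G k : ℝ)) * (2 * ∑ p ∈ P, e p) :=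
        hcs.trans (mul_le_mul hsum hP
          (Finset.sum_nonneg fun k _ => Finset.sum_nonneg fun p _ => he0 p)
          (mul_nonneg (by norm_num) (tsum_nonneg fun k => by positivity)))
    _ = _ := by ring

/-! ### The core contains the dyadic boxes -/

theorem abs_add_abs_add_abs_le_length {p q : ℤ × ℤ × ℤ} (w : lattice.Walk p q) :
    |p.1 - q.1| + |p.2.1 - q.2.1| + |p.2.2 - q.2.2| ≤ w.length := by
  induction w with
  | nil => simp
  | @cons u v t huv w ih =>
    have h1 : |u.1 - v.1| + |u.2.1 - v.2.1| + |u.2.2 - v.2.2| = 1 := huv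
    rw [SimpleGraph.Walk.length_cons]
    push_cast
    linarith [abs_sub_le u.1 v.1 t.1, abs_sub_le u.2.1 v.2.1 t.2.1, abs_sub_le u.2.2 v.2.2 t.2.2]

theorem exists_adj_closer {p q : ℤ × ℤ × ℤ} (h : p ≠ q) :
    ∃ r, lattice.Adj p r ∧ |r.1 - q.1| + |r.2.1 - q.2.1| + |r.2.2 - q.2.2| + 1 =
      |p.1 - q.1| + |p.2.1 - q.2.1| + |p.2.2 - q.2.2| := by
  have one_step : ∀ {a b : ℤ}, a ≠ b → ∃ c, |a - c| = 1 ∧ |c - b| + 1 = |a - b| := by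
    intro a b hab
    rcases lt_or_gt_of_ne hab with h | h
    · exact ⟨a + 1, by grind, by grind⟩
    · exact ⟨a - 1, by grind, by grind⟩
  obtain ⟨x, y, z⟩ := p
  obtain ⟨x', y', z'⟩ := q
  by_cases hx : x = x'
  · by_cases hy : y = y'
    · have hz : z ≠ z' := fun hz => h (by rw [hx, hy, hz])
      obtain ⟨c, hc1, hc2⟩ := one_step hz
      exact ⟨(x, y, c), by simpa [lattice] using hc1, by simp only; omega⟩
    · obtain ⟨c, hc1, hc2⟩ := one_step hy
      exact ⟨(x, c, z), by simpa [lattice] using hc1, by simp only; omega⟩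
  · obtain ⟨c, hc1, hc2⟩ := one_step hx
    exact ⟨(c, y, z), by simpa [lattice] using hc1, by simp only; omega⟩

theorem exists_walk_length_eq (n : ℕ) (p q : ℤ × ℤ × ℤ)
    (h : |p.1 - q.1| + |p.2.1 - q.2.1| + |p.2.2 - q.2.2| = n) :
    ∃ w : lattice.Walk p q, w.length = n := by
  induction n generalizing p with
  | zero =>
    have hpq : p = q := by
      refine Prod.ext ?_ (Prod.ext ?_ ?_) <;> push_cast at h <;> grind
    subst hpq
    exact ⟨.nil, rfl⟩
  | succ n ih =>
    have hpq : p ≠ q := by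
      rintro rfl
      simp at h
      omega
    obtain ⟨r, hr, hrq⟩ := exists_adj_closer hpq
    obtain ⟨w, hw⟩ := ih r (by push_cast at h; omega)
    exact ⟨.cons hr w, by rw [SimpleGraph.Walk.length_cons, hw]⟩

/-- The graph metric of the lattice is the `ℓ¹`-distance. -/
theorem lattice_dist (p q : ℤ × ℤ × ℤ) :
    (lattice.dist p q : ℤ) = |p.1 - q.1| + |p.2.1 - q.2.1| + |p.2.2 - q.2.2| := by
  obtain ⟨n, hn⟩ := Int.eq_ofNat_of_zero_le
    (by positivity : 0 ≤ |p.1 - q.1| + |p.2.1 - q.2.1| + |p.2.2 - q.2.2|)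
  obtain ⟨w, hw⟩ := exists_walk_length_eq n p q hn
  obtain ⟨w', hw'⟩ := w.reachable.exists_walk_length_eq_dist
  have h1 := abs_add_abs_add_abs_le_length w'
  have h2 := SimpleGraph.dist_le w
  omega

theorem eventually_mul_lt_of_summable {f : ℕ → ℝ} (hf : Antitone f) (hs : Summable f) (C : ℝ) :
    ∀ᶠ j : ℕ in Filter.atTop, C * ((j : ℝ) + 4) * f j < 1 / 2 := by
  have h1 : Filter.Tendsto (fun j : ℕ => C * ((j : ℝ) * f j) + C * 4 * f j) Filter.atTop
      (nhds (C * 0 + C * 4 * 0)) :=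
    ((tendsto_mul_of_antitone_summable hf hs).const_mul C).add
      (hs.tendsto_atTop_zero.const_mul (C * 4))
  filter_upwards [h1.eventually_lt_const (u := 1 / 2) (by norm_num)] with j hj
  linarith

/-- The embedding of `ℕ³` as the octant of points with nonnegative coordinates. -/
def octant (p : ℕ × ℕ × ℕ) : ℤ × ℤ × ℤ := (p.1, p.2.1, p.2.2)

theorem octant_injective : Function.Injective octant := by
  rintro ⟨x, y, z⟩ ⟨x', y', z'⟩ h
  simpa [octant] using h

/-- The heights of the dyadic boxes: about half of the height of the wedge at half of the
abscissa where the box starts, cut off at `2 ^ k`. -/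
noncomputable def boxHeight (h : ℝ → ℝ) (k : ℕ) : ℕ := min (2 ^ k) (height h (2 ^ (k - 1)) / 2 + 1)

theorem boxHeight_monotone {h : ℝ → ℝ} (hmono : MonotoneOn h (Set.Ici 0)) :
    Monotone (boxHeight h) := by
  intro j k hjk
  have h1 : 2 ^ j ≤ 2 ^ k := Nat.pow_le_pow_right (by norm_num) hjk
  have h2 := height_monotone hmono
    (Nat.pow_le_pow_right (n := 2) (by norm_num) (Nat.sub_le_sub_right hjk 1))
  unfold boxHeight
  omega

theorem one_le_boxHeight (h : ℝ → ℝ) (k : ℕ) : 1 ≤ boxHeight h k :=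
  le_min Nat.one_le_two_pow (by omega)

theorem summable_inv_boxHeight {h : ℝ → ℝ}
    (hs : Summable fun k : ℕ => 1 / ((height h (2 ^ k) : ℝ) + 1)) :
    Summable fun k => 1 / (boxHeight h k : ℝ) := by
  have h1 : Summable fun k : ℕ => 1 / ((height h (2 ^ (k - 1)) : ℝ) + 1) :=
    (summable_nat_add_iff 1).1 (by simpa using hs)
  have h2 : Summable fun k : ℕ => ((1 : ℝ) / 2) ^ k := summable_geometric_two
  refine Summable.of_nonneg_of_le (fun k => by positivity) (fun k => ?_) (h2.add (h1.mul_left 2))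
  set a := height h (2 ^ (k - 1)) with ha
  rcases min_choice (2 ^ k) (a / 2 + 1) with hmin | hmin
  · have : 0 ≤ 2 * (1 / ((a : ℝ) + 1)) := by positivity
    rw [boxHeight, ← ha, hmin, one_div_pow]
    push_cast
    linarith
  · have h3 : ((a : ℝ) + 1) / 2 ≤ ((a / 2 + 1 : ℕ) : ℝ) := by
      have : a + 1 ≤ (a / 2 + 1) * 2 := by omega
      rw [div_le_iff₀ (by norm_num)]
      exact_mod_cast this
    have h4 : 1 / ((a / 2 + 1 : ℕ) : ℝ) ≤ 1 / (((a : ℝ) + 1) / 2) :=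
      one_div_le_one_div_of_le (by positivity) h3
    have h5 : 1 / (((a : ℝ) + 1) / 2) = 2 * (1 / ((a : ℝ) + 1)) := by field_simp
    have : 0 ≤ ((1 : ℝ) / 2) ^ k := by positivity
    rw [boxHeight, ← ha, hmin]
    linarith

theorem abs_natCast_sub_le (n : ℕ) (b : ℤ) : |(n : ℤ) - b| ≤ n + |b| := by
  simpa using abs_sub (n : ℤ) b

theorem abs_le_natCast_add (n : ℕ) (b : ℤ) : |b| ≤ n + |(n : ℤ) - b| := by
  have := abs_sub_abs_le_abs_sub b n
  rw [abs_sub_comm, Nat.abs_cast] at this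
  omega

/-- Far from the origin, the points of the dyadic boxes lie in the core: a vertex outside the wedge
has abscissa less than `2 ^ (k - 1)`, or its height exceeds the height of the wedge at
`2 ^ (k - 1)`, and both `2 ^ k` and the height at `2 ^ k` grow faster than `k`. -/
theorem exists_octant_mem_core {h : ℝ → ℝ} (hmono : MonotoneOn h (Set.Ici 0))
    (hs : Summable fun k : ℕ => 1 / ((height h (2 ^ k) : ℝ) + 1))
    (v₀ : ℤ × ℤ × ℤ) {C : ℝ} (hC : 0 < C) :
    ∃ k₀, ∀ k, k₀ ≤ k → ∀ x y z, 2 ^ k ≤ x → x < 2 ^ (k + 2) → y < 2 ^ (k + 1) →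
      z < boxHeight h k → octant (x, y, z) ∈ core lattice C v₀ (wedge h) := by
  have hanti : Antitone fun k : ℕ => 1 / ((height h (2 ^ k) : ℝ) + 1) := by
    intro j k hjk
    have := height_monotone hmono (Nat.pow_le_pow_right (n := 2) (by norm_num) hjk)
    dsimp only
    gcongr
  have hanti2 : Antitone fun k : ℕ => ((1 : ℝ) / 2) ^ k :=
    pow_right_anti₀ (by norm_num) (by norm_num)
  -- the constant `C + 1` ensures that the height is positive as well
  obtain ⟨j₀, hj₀⟩ := Filter.eventually_atTop.1
    ((eventually_mul_lt_of_summable hanti hs (C + 1)).and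
      (eventually_mul_lt_of_summable hanti2 summable_geometric_two (C + 1)))
  obtain ⟨R, hR⟩ := Int.eq_ofNat_of_zero_le
    (by positivity : 0 ≤ |v₀.1| + |v₀.2.1| + |v₀.2.2|)
  refine ⟨j₀ + R + 1, fun k hk x y z hx hx' hy hz => ?_⟩
  obtain ⟨j, rfl⟩ : ∃ j, k = j + 1 := ⟨k - 1, by omega⟩
  obtain ⟨e1, e2⟩ := hj₀ j (by omega)
  rw [mul_one_div, div_lt_iff₀ (by positivity)] at e1
  rw [one_div_pow, mul_one_div, div_lt_iff₀ (by positivity)] at e2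
  have p1 : 2 ^ (j + 1) = 2 * 2 ^ j := by ring
  have p2 : 2 ^ (j + 1 + 1) = 4 * 2 ^ j := by ring
  have p3 : 2 ^ (j + 1 + 2) = 8 * 2 ^ j := by ring
  rw [p1] at hx
  rw [p3] at hx'
  rw [p2] at hy
  rw [boxHeight, Nat.add_sub_cancel, p1] at hz
  set a := height h (2 ^ j) with ha
  set L := 2 ^ j with hL
  have hLj : j + 1 ≤ L := Nat.lt_two_pow_self
  have hLr : (2 : ℝ) ^ j = (L : ℝ) := by rw [hL]; push_cast; rfl
  rw [hLr] at e2
  have hz1 : z ≤ a / 2 := by omega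
  have hz2 : z < 2 * L := by omega
  have hj0 : (0 : ℝ) ≤ j := Nat.cast_nonneg j
  have hapos : 0 < a := by
    rcases Nat.eq_zero_or_pos a with h0 | h0
    · rw [h0] at e1
      push_cast at e1
      nlinarith
    · exact h0
  have haL : (a : ℝ) ≤ h L := by
    refine Nat.floor_le ?_
    by_contra hneg
    have : a = 0 := Nat.floor_of_nonpos (le_of_lt (not_le.1 hneg))
    omega
  have hmem : octant (x, y, z) ∈ wedge h := by
    refine ⟨Int.natCast_nonneg x, ?_⟩
    have h1 : h L ≤ h x := hmono (by simp) (by simp) (by exact_mod_cast (by omega : L ≤ x))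
    have h2 : (z : ℝ) ≤ a := by exact_mod_cast (by omega : z ≤ a)
    simp only [octant, Int.cast_natCast, Nat.abs_cast]
    linarith
  refine ⟨hmem, fun w hw => ?_⟩
  have hlog : Real.log (lattice.dist (octant (x, y, z)) v₀) ≤ (j : ℝ) + 4 := by
    have hd := lattice_dist (octant (x, y, z)) v₀
    have hdle : lattice.dist (octant (x, y, z)) v₀ ≤ 2 ^ (j + 4) := by
      have p4 : 2 ^ (j + 4) = 16 * L := by rw [hL]; ring
      have h1 := abs_natCast_sub_le x v₀.1
      have h2 := abs_natCast_sub_le y v₀.2.1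
      have h3 := abs_natCast_sub_le z v₀.2.2
      rw [p4]
      zify
      rw [hd]
      simp only [octant]
      omega
    rcases Nat.eq_zero_or_pos (lattice.dist (octant (x, y, z)) v₀) with h0 | h0
    · rw [h0]
      simp
      linarith
    · calc Real.log (lattice.dist (octant (x, y, z)) v₀) ≤ Real.log ((2 : ℝ) ^ (j + 4)) :=
            Real.log_le_log (by exact_mod_cast h0) (by exact_mod_cast hdle)
        _ = ((j : ℝ) + 4) * Real.log 2 := by rw [Real.log_pow]; push_cast; ring
        _ ≤ ((j : ℝ) + 4) * 1 := by
            gcongr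
            linarith [Real.log_two_lt_d9]
        _ = _ := mul_one _
  have hClog : C * Real.log (lattice.dist (octant (x, y, z)) v₀) ≤ (C + 1) * ((j : ℝ) + 4) := by
    have := mul_le_mul_of_nonneg_left hlog hC.le
    nlinarith
  refine hClog.trans_lt ?_
  have hd := lattice_dist (octant (x, y, z)) w
  by_cases hwx : w.1 < L
  · have h1 : L ≤ lattice.dist (octant (x, y, z)) w := by
      have h1 := le_abs_self ((x : ℤ) - w.1)
      have h2 := abs_nonneg ((y : ℤ) - w.2.1)
      have h3 := abs_nonneg ((z : ℤ) - w.2.2)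
      zify
      rw [hd]
      simp only [octant]
      omega
    have h2 : (L : ℝ) ≤ lattice.dist (octant (x, y, z)) w := by exact_mod_cast h1
    have : (0 : ℝ) < L := by rw [← hLr]; positivity
    linarith
  · have hw1 : (L : ℝ) ≤ w.1 := by exact_mod_cast not_lt.1 hwx
    have hw0 : (0 : ℤ) ≤ w.1 := le_trans (by positivity) (not_lt.1 hwx)
    have h1 : h L ≤ h w.1 := hmono (by simp) (by simpa using hw0) hw1
    have h2 : h w.1 < |(w.2.2 : ℝ)| := by
      by_contra hle
      exact hw.1 ⟨hw0, not_lt.1 hle⟩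
    have h3 : (a : ℤ) < |w.2.2| := by
      have : (a : ℝ) < |(w.2.2 : ℝ)| := by linarith
      exact_mod_cast this
    have h4 : a + 1 ≤ 2 * lattice.dist (octant (x, y, z)) w := by
      have h1 := abs_nonneg ((x : ℤ) - w.1)
      have h2 := abs_nonneg ((y : ℤ) - w.2.1)
      have h3 := abs_le_natCast_add z w.2.2
      zify
      rw [hd]
      simp only [octant]
      omega
    have h5 : (a : ℝ) + 1 ≤ 2 * lattice.dist (octant (x, y, z)) w := by exact_mod_cast h4
    linarith

/-! ### Transience of the core -/

theorem le_card_mul_dyadicAvg {F : ℕ × ℕ × ℕ → ℝ} (hF : ∀ p, 0 ≤ F p) {G : ℕ → ℕ} {k : ℕ}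
    (hG : 1 ≤ G k) :
    F (2 ^ k, 0, 0) ≤ 2 ^ k * 2 ^ k * G k * dyadicAvg F G k := by
  have hp : 2 ^ (k + 1) = 2 * 2 ^ k := by ring
  have hL : 0 < 2 ^ k := by positivity
  have hg : (0 : ℝ) < G k := by exact_mod_cast hG
  have hcard : (Finset.Ico (2 ^ k) (2 ^ (k + 1))).card = 2 ^ k := by rw [Nat.card_Ico]; omega
  unfold dyadicAvg boxAvg
  rw [hcard, Finset.card_range, Finset.card_range]
  push_cast
  rw [mul_div_cancel₀ _ (by positivity)]
  calc F (2 ^ k, 0, 0) ≤ ∑ z ∈ Finset.range (G k), F (2 ^ k, 0, z) :=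
        Finset.single_le_sum (f := fun z => F (2 ^ k, 0, z)) (fun z _ => hF _)
          (Finset.mem_range.2 hG)
    _ ≤ ∑ y ∈ Finset.range (2 ^ k), ∑ z ∈ Finset.range (G k), F (2 ^ k, y, z) :=
        Finset.single_le_sum (f := fun y => ∑ z ∈ Finset.range (G k), F (2 ^ k, y, z))
          (fun y _ => Finset.sum_nonneg fun z _ => hF _) (Finset.mem_range.2 hL)
    _ ≤ _ :=
        Finset.single_le_sum (f := fun x => ∑ y ∈ Finset.range (2 ^ k),
          ∑ z ∈ Finset.range (G k), F (x, y, z))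
          (fun x _ => Finset.sum_nonneg fun y _ => Finset.sum_nonneg fun z _ => hF _)
          (Finset.mem_Ico.2 ⟨le_rfl, by omega⟩)

/-- An induced subgraph of the lattice that contains all points of the dyadic boxes from some scale
on is transient, provided that the sum of the inverses of the heights converges. -/
theorem transient_of_dyadic_boxes {G : ℕ → ℕ} (hG : Monotone G) (hG1 : ∀ k, 1 ≤ G k)
    (hG2 : ∀ k, G k ≤ 2 ^ k) (hGs : Summable fun k => 1 / (G k : ℝ)) {B : Set (ℤ × ℤ × ℤ)} {k₀ : ℕ}
    (hB : ∀ k, k₀ ≤ k → ∀ x y z, 2 ^ k ≤ x → x < 2 ^ (k + 2) → y < 2 ^ (k + 1) → z < G k →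
      octant (x, y, z) ∈ B) : Transient (lattice.induce B) := by
  classical
  have hp : 2 ^ (k₀ + 2) = 4 * 2 ^ k₀ := by ring
  have hL : 0 < 2 ^ k₀ := by positivity
  have ho : octant (2 ^ k₀, 0, 0) ∈ B :=
    hB k₀ le_rfl _ _ _ le_rfl (by omega) (by positivity) (hG1 k₀)
  set M : ℝ := (2 ^ k₀ * 2 ^ k₀ * G k₀) ^ 2 * (30 * ∑' k, 1 / (G k : ℝ)) with hM
  have hM0 : 0 ≤ M := mul_nonneg (sq_nonneg _)
    (mul_nonneg (by norm_num) (tsum_nonneg fun k => by positivity))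
  refine transient_of_le_energy (o := ⟨_, ho⟩) (c := 1 / (M + 1)) (by positivity)
    fun f S hf hS => ?_
  set en : B → ℝ := fun v => ∑ w ∈ (lattice.induce B).neighborFinset v, (f v - f w) ^ 2 with hen
  have hen0 : ∀ v, 0 ≤ en v := fun v => Finset.sum_nonneg fun w _ => sq_nonneg _
  set F : ℕ × ℕ × ℕ → ℝ := fun p => if hp : octant p ∈ B then f ⟨octant p, hp⟩ else 0 with hF
  set e : ℕ × ℕ × ℕ → ℝ := fun p => if hp : octant p ∈ B then en ⟨octant p, hp⟩ else 0 with he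
  have hF0 : ∀ p, 0 ≤ F p := fun p => by
    simp only [hF]; split_ifs; exacts [hf _, le_rfl]
  have he0 : ∀ p, 0 ≤ e p := fun p => by
    simp only [he]; split_ifs; exacts [hen0 _, le_rfl]
  have hedge : ∀ p q, octant p ∈ B → octant q ∈ B → lattice.Adj (octant p) (octant q) →
      (F q - F p) ^ 2 ≤ e p := by
    intro p q hp hq hpq
    simp only [hF, he, dif_pos hp, dif_pos hq]
    rw [← neg_sub, neg_sq]
    exact Finset.single_le_sum
      (f := fun w => (f ⟨octant p, hp⟩ - f w) ^ 2) (fun w _ => sq_nonneg _)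
      (by simpa using hpq)
  obtain ⟨P, hP⟩ := sq_dyadicAvg_le_energy (A := {p | octant p ∈ B}) he0 hG hG1 hG2 hGs
    (fun x y z hp hq => hedge _ _ hp hq (by simp [lattice, octant]))
    (fun x y z hp hq => hedge _ _ hp hq (by simp [lattice, octant]))
    (fun x y z hp hq => hedge _ _ hp hq (by simp [lattice, octant])) hB
    (N := S.sup (fun v => v.1.1.natAbs) + 1) fun x y z hx => by
      simp only [hF]
      split_ifs with hp
      · refine hS _ fun hmem => ?_
        have := Finset.le_sup (f := fun v : B => v.1.1.natAbs) hmem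
        simp [octant] at this
        omega
      · rfl
  refine ⟨(P.subtype fun p => octant p ∈ B).map ⟨fun p => ⟨octant p.1, p.2⟩, fun p q hpq =>
    Subtype.ext (octant_injective (congrArg Subtype.val hpq))⟩, ?_⟩
  have hsum : ∑ v ∈ (P.subtype fun p => octant p ∈ B).map ⟨fun p => ⟨octant p.1, p.2⟩,
      fun p q hpq => Subtype.ext (octant_injective (congrArg Subtype.val hpq))⟩, en v =
      ∑ p ∈ P, e p := by
    rw [Finset.sum_map]
    calc _ = ∑ p ∈ P.subtype (fun p => octant p ∈ B), e p.1 :=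
          Finset.sum_congr rfl fun p _ => by simp only [he, dif_pos p.2]; rfl
      _ = ∑ p ∈ P with octant p ∈ B, e p := Finset.sum_subtype_eq_sum_filter (f := e)
      _ = ∑ p ∈ P, e p := by
          refine Finset.sum_filter_of_ne fun p _ hne => ?_
          by_contra hp
          exact hne (by simp only [he, dif_neg hp])
  rw [hsum]
  have hE : 0 ≤ ∑ p ∈ P, e p := Finset.sum_nonneg fun p _ => he0 p
  have hfo : f ⟨_, ho⟩ = F (2 ^ k₀, 0, 0) := by simp only [hF, dif_pos ho]
  have h1 := le_card_mul_dyadicAvg hF0 (hG1 k₀)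
  have h2 : F (2 ^ k₀, 0, 0) ^ 2 ≤ M * ∑ p ∈ P, e p := by
    calc F (2 ^ k₀, 0, 0) ^ 2 ≤ (2 ^ k₀ * 2 ^ k₀ * G k₀ * dyadicAvg F G k₀) ^ 2 :=
          pow_le_pow_left₀ (hF0 _) h1 2
      _ = (2 ^ k₀ * 2 ^ k₀ * G k₀) ^ 2 * dyadicAvg F G k₀ ^ 2 := mul_pow _ _ _
      _ ≤ (2 ^ k₀ * 2 ^ k₀ * G k₀) ^ 2 * ((30 * ∑' k, 1 / (G k : ℝ)) * ∑ p ∈ P, e p) := by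
          gcongr
      _ = _ := by rw [hM]; ring
  rw [hfo, div_mul_eq_mul_div, one_mul, div_le_iff₀ (by positivity)]
  linarith

end WedgeCore

theorem mainTheorem8 (h : ℝ → ℝ) (hmono : MonotoneOn h (Set.Ici 0))
    (htrans : WedgeCore.Transient (WedgeCore.lattice.induce (WedgeCore.wedge h)))
    (v₀ : ℤ × ℤ × ℤ) (C : ℝ) (hC : 0 < C) :
    WedgeCore.Transient (WedgeCore.lattice.induce
      (WedgeCore.core WedgeCore.lattice C v₀ (WedgeCore.wedge h))) := by
  have hs := WedgeCore.summable_inv_height hmono htrans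
  obtain ⟨k₀, hk₀⟩ := WedgeCore.exists_octant_mem_core hmono hs v₀ hC
  exact WedgeCore.transient_of_dyadic_boxes (WedgeCore.boxHeight_monotone hmono)
    (WedgeCore.one_le_boxHeight h) (fun k => min_le_left _ _)
    (WedgeCore.summable_inv_boxHeight hs) hk₀
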